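/- Let $T>0$, let $w_k(x)=\sqrt{2/\pi}\,\sin(kx)$ ($k\ge 1$) be the $L^2$-normalized Dirichlet eigenfunctions of $-\partial_{xx}$ on $(0,\pi)$, and let $\alpha\in L^\infty(0,\pi)$ be $$\alpha(x)=\sum_{j=1}^{\infty}\frac{1}{j^2}\cos(15jx),\qquad x\in(0,\pi).$$ For $y_0,z_0\in H^{-1}(0,\pi)$ and $v\in L^2(0,T)$ consider the system with boundary control $v$ $$\begin{cases}\partial_t y=\partial_{xx}y+\alpha z,\quad \partial_t z=\partial_{xx}z & \text{in }(0,\pi)\times(0,T),\\ y(0,t)=v(t),\quad y(\pi,t)=z(0,t)=z(\pi,t)=0 & \text{on }(0,T),\\ y(\cdot,0)=y_0,\quad z(\cdot,0)=z_0 & \text{in }(0,\pi).\end{cases}$$ A solution (by transposition) is a pair $(y,z)\in \big(L^2((0,\pi)\times(0,T))\cap C^0([0,T];H^{-1}(0,\pi))\big)^2$ such that, for every $\tau\in[0,T]$ and all $\varphi,\psi\in C^\infty(\mathbb R^2)$ vanishing for $x=0$ and for $x=\pi$, $$\langle y(\tau),\varphi(\cdot,\tau)\rangle-\langle y_0,\varphi(\cdot,0)\rangle=\int_0^\tau\!\!\int_0^\pi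 \big(y(\partial_t\varphi+\partial_{xx}\varphi)+\alpha z\varphi\big)\,dx\,dt+\int_0^\tau v(t)\,\partial_x\varphi(0,t)\,dt,$$ $$\langle z(\tau),\psi(\cdot,\tau)\rangle-\langle z_0,\psi(\cdot,0)\rangle=\int_0^\tau\!\!\int_0^\pi z(\partial_t\psi+\partial_{xx}\psi)\,dx\,dt,$$ where $\langle\cdot,\cdot\rangle$ is the duality between $H^{-1}(0,\pi)$ and $H^1_0(0,\pi)$. Then there exists $k_1\in\{1,\dots,7\}$ such that, for the initial data $(y_0,z_0)=(0,w_{k_1})$ and every control $v\in L^2(0,T)$, the system has a solution, and every solution $(y,z)$ of it satisfies $y(T)\not\equiv 0$ in $(0,\pi)$ (that is, $y(T)\neq 0$ in $H^{-1}(0,\pi)$). -/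

import Mathlib

open MeasureTheory Set
open scoped ContDiff Real

noncomputable section

namespace HeatControl

/-- Lebesgue measure on the space interval `(0, π)`. -/
abbrev μΩ : Measure ℝ := volume.restrict (Ioo 0 π)

/-- The real Hilbert space `L²(0, π)`. -/
abbrev L2 : Type := Lp ℝ 2 μΩ

lemma memLp_of_continuous {f : ℝ → ℝ} (hf : Continuous f) : MemLp f 2 μΩ := by
  obtain ⟨C, hC⟩ := isCompact_Icc.exists_bound_of_continuousOn (s := Icc 0 π) hf.continuousOn
  refine MemLp.of_bound hf.aestronglyMeasurable C ?_
  filter_upwards [ae_restrict_mem measurableSet_Ioo] with x hx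
  exact hC x (Ioo_subset_Icc_self hx)

/-- The function `f ∈ C(ℝ)`, seen in `L²(0, π)`. -/
def toL2 (f : ℝ → ℝ) (hf : Continuous f) : L2 := (memLp_of_continuous hf).toLp f

lemma integrable_mul_of_continuous (p : L2) {χ : ℝ → ℝ} (hχ : Continuous χ) :
    Integrable (fun x => p x * χ x) μΩ :=
  (Lp.memLp p).integrable_mul (memLp_of_continuous hχ)

/-- The Sobolev space `H¹₀(0, π)`, with the `H¹` inner product: the pairs `(u, u')` in
`L²(0, π) × L²(0, π)` such that the extension of `u` by zero to `ℝ` has the extension of `u'`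
by zero as weak derivative on `ℝ`. (The test functions `χ` need not vanish at `0` and `π`; this
encodes `u(0) = u(π) = 0`.) -/
def H10 : Submodule ℝ (WithLp 2 (L2 × L2)) where
  carrier := {p | ∀ χ : ℝ → ℝ, ContDiff ℝ ∞ χ → HasCompactSupport χ →
    ∫ x in Ioo 0 π, p.fst x * deriv χ x = - ∫ x in Ioo 0 π, p.snd x * χ x}
  zero_mem' := by
    intro χ _ _
    have h0 : ((0 : L2) : ℝ → ℝ) =ᵐ[μΩ] 0 := Lp.coeFn_zero ℝ 2 μΩ
    have e1 : ∫ x in Ioo 0 π, (0 : L2) x * deriv χ x = 0 := by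
      rw [integral_congr_ae (g := fun _ => (0 : ℝ)) (h0.mono fun x hx => by
        beta_reduce; rw [hx]; simp)]
      simp
    have e2 : ∫ x in Ioo 0 π, (0 : L2) x * χ x = 0 := by
      rw [integral_congr_ae (g := fun _ => (0 : ℝ)) (h0.mono fun x hx => by
        beta_reduce; rw [hx]; simp)]
      simp
    change ∫ x in Ioo 0 π, (0 : L2) x * deriv χ x = - ∫ x in Ioo 0 π, (0 : L2) x * χ x
    rw [e1, e2, neg_zero]
  add_mem' := by
    intro p q hp hq χ hχ hc
    have key : ∀ (a b : L2) {ξ : ℝ → ℝ}, Continuous ξ →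
        ∫ x in Ioo 0 π, (a + b : L2) x * ξ x
          = (∫ x in Ioo 0 π, a x * ξ x) + ∫ x in Ioo 0 π, b x * ξ x := by
      intro a b ξ hξ
      rw [← integral_add (integrable_mul_of_continuous a hξ) (integrable_mul_of_continuous b hξ)]
      exact integral_congr_ae ((Lp.coeFn_add a b).mono fun x hx => by
        beta_reduce; rw [hx, Pi.add_apply, add_mul])
    have hd : Continuous (deriv χ) := hχ.continuous_deriv (by simp)
    have h1 := hp χ hχ hc
    have h2 := hq χ hχ hc
    have e1 := key p.fst q.fst hd
    have e2 := key p.snd q.snd hχ.continuous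
    simp only [WithLp.add_fst, WithLp.add_snd]
    rw [e1, e2, h1, h2]; ring
  smul_mem' := by
    intro c p hp χ hχ hc
    have key : ∀ (a : L2) (ξ : ℝ → ℝ),
        ∫ x in Ioo 0 π, (c • a : L2) x * ξ x = c * ∫ x in Ioo 0 π, a x * ξ x := by
      intro a ξ
      rw [← integral_const_mul]
      exact integral_congr_ae ((Lp.coeFn_smul c a).mono fun x hx => by
        beta_reduce; rw [hx, Pi.smul_apply, smul_eq_mul, mul_assoc])
    have h1 := hp χ hχ hc
    simp only [WithLp.smul_fst, WithLp.smul_snd]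
    rw [key, key, h1]; ring

/-- The space `H⁻¹(0, π)`, the topological dual of `H¹₀(0, π)`. -/
abbrev Hneg1 : Type := H10 →L[ℝ] ℝ

/-- The embedding of `L²(0, π)` in `H⁻¹(0, π)`: `⟨f, u⟩ = ∫₀^π f u dx`. -/
def L2.toHneg1 (f : L2) : Hneg1 :=
  (innerSL ℝ f).comp ((WithLp.fstL 2 ℝ L2 L2).comp H10.subtypeL)

/-- A `C¹` function vanishing at `0` and `π`, as an element of `H¹₀(0, π)`. -/
def H10.ofC1 (u : ℝ → ℝ) (hu : ContDiff ℝ 1 u) (h0 : u 0 = 0) (hπ : u π = 0) : H10 :=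
  ⟨WithLp.toLp 2 (toL2 u hu.continuous, toL2 (deriv u) (hu.continuous_deriv le_rfl)), by
    intro χ hχ _
    have hd : Continuous (deriv χ) := hχ.continuous_deriv (by simp)
    have hdu : Continuous (deriv u) := hu.continuous_deriv le_rfl
    have e1 : ∫ x in Ioo 0 π, toL2 u hu.continuous x * deriv χ x
        = ∫ x in Ioo 0 π, u x * deriv χ x :=
      integral_congr_ae ((MemLp.coeFn_toLp (memLp_of_continuous hu.continuous)).mono fun x hx => by
        beta_reduce; rw [toL2, hx])
    have e2 : ∫ x in Ioo 0 π, toL2 (deriv u) hdu x * χ x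
        = ∫ x in Ioo 0 π, deriv u x * χ x :=
      integral_congr_ae ((MemLp.coeFn_toLp (memLp_of_continuous hdu)).mono fun x hx => by
        beta_reduce; rw [toL2, hx])
    have e3 := intervalIntegral.integral_mul_deriv_eq_deriv_mul (a := 0) (b := π)
      (u := u) (v := χ) (u' := deriv u) (v' := deriv χ)
      (fun x _ => (hu.differentiable (by simp) x).hasDerivAt)
      (fun x _ => (hχ.differentiable (by simp) x).hasDerivAt)
      (hdu.intervalIntegrable _ _) (hd.intervalIntegrable _ _)
    rw [intervalIntegral.integral_of_le Real.pi_pos.le,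
      intervalIntegral.integral_of_le Real.pi_pos.le,
      integral_Ioc_eq_integral_Ioo, integral_Ioc_eq_integral_Ioo, h0, hπ] at e3
    change ∫ x in Ioo 0 π, toL2 u hu.continuous x * deriv χ x
      = - ∫ x in Ioo 0 π, toL2 (deriv u) hdu x * χ x
    rw [e1, e2, e3]; ring⟩

/-- Smooth functions `φ(x, t)` that vanish for `x = 0` and for `x = π`. -/
structure TestFunction where
  /-- The underlying function of `(x, t)`. -/
  toFun : ℝ → ℝ → ℝ
  smooth : ContDiff ℝ ∞ (fun q : ℝ × ℝ => toFun q.1 q.2)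
  left : ∀ t, toFun 0 t = 0
  right : ∀ t, toFun π t = 0

namespace TestFunction

/-- The function `φ(·, t)` in `H¹₀(0, π)`. -/
def slice (φ : TestFunction) (t : ℝ) : H10 :=
  H10.ofC1 (fun x => φ.toFun x t)
    ((φ.smooth.comp (contDiff_id.prodMk contDiff_const)).of_le (by simp)) (φ.left t) (φ.right t)

/-- `∂ₜ φ (x, t)`. -/
def dt (φ : TestFunction) (x t : ℝ) : ℝ := deriv (fun s => φ.toFun x s) t

/-- `∂ₓ φ (x, t)`. -/
def dx (φ : TestFunction) (x t : ℝ) : ℝ := deriv (fun ξ => φ.toFun ξ t) x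

/-- `∂ₓₓ φ (x, t)`. -/
def dxx (φ : TestFunction) (x t : ℝ) : ℝ := iteratedDeriv 2 (fun ξ => φ.toFun ξ t) x

end TestFunction

/-- The square integrable function `f(x, t)` on `(0, π) × (0, T)` and the continuous curve
`F : [0, T] → H⁻¹(0, π)` are one and the same element of
`L²((0, π) × (0, T)) ∩ C⁰([0, T]; H⁻¹(0, π))`. -/
structure IsL2CurveRep (T : ℝ) (f : ℝ × ℝ → ℝ) (F : ℝ → Hneg1) : Prop where
  memLp : MemLp f 2 (volume.restrict (Ioo 0 π ×ˢ Ioo 0 T))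
  continuousOn : ContinuousOn F (Icc 0 T)
  eq_ae : ∀ᵐ t ∂(volume.restrict (Ioo 0 T)),
    ∃ h : MemLp (fun x => f (x, t)) 2 μΩ, F t = L2.toHneg1 (h.toLp (fun x => f (x, t)))

/-- `(y, z) ∈ (L²((0, π) × (0, T)) ∩ C⁰([0, T]; H⁻¹(0, π)))²` is the solution by transposition
(`Y` and `Z` are `y` and `z` as continuous curves in `H⁻¹(0, π)`) of the system
`∂ₜ y = ∂ₓₓ y + α z`, `∂ₜ z = ∂ₓₓ z` in `(0, π) × (0, T)`, with
`y(0, t) = v(t)`, `y(π, t) = z(0, t) = z(π, t) = 0`, `y(·, 0) = y₀`, `z(·, 0) = z₀`. -/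
structure IsTranspositionSolution (T : ℝ) (α : ℝ → ℝ) (y₀ z₀ : Hneg1) (v : ℝ → ℝ)
    (y z : ℝ × ℝ → ℝ) (Y Z : ℝ → Hneg1) : Prop where
  rep_y : IsL2CurveRep T y Y
  rep_z : IsL2CurveRep T z Z
  eq_y : ∀ τ ∈ Icc 0 T, ∀ φ : TestFunction,
    Y τ (φ.slice τ) - y₀ (φ.slice 0)
      = (∫ q in Ioo 0 π ×ˢ Ioo 0 τ,
          (y q * (φ.dt q.1 q.2 + φ.dxx q.1 q.2) + α q.1 * z q * φ.toFun q.1 q.2))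
        + ∫ t in Ioo 0 τ, v t * φ.dx 0 t
  eq_z : ∀ τ ∈ Icc 0 T, ∀ ψ : TestFunction,
    Z τ (ψ.slice τ) - z₀ (ψ.slice 0)
      = ∫ q in Ioo 0 π ×ˢ Ioo 0 τ, z q * (ψ.dt q.1 q.2 + ψ.dxx q.1 q.2)

/-- The `k`-th `L²`-normalized Dirichlet eigenfunction `√(2/π) sin(k x)` of `-d²/dx²` on
`(0, π)`. -/
def eigenfunction (k : ℕ) (x : ℝ) : ℝ := √(2 / π) * Real.sin (k * x)

lemma continuous_eigenfunction (k : ℕ) : Continuous (eigenfunction k) := by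
  unfold eigenfunction; fun_prop

/-- The eigenfunction `w_k` as an element of `H⁻¹(0, π)`. -/
def w (k : ℕ) : Hneg1 := L2.toHneg1 (toL2 (eigenfunction k) (continuous_eigenfunction k))

/-- The coupling coefficient `α(x) = ∑_{j ≥ 1} j⁻² cos(15 j x)`. -/
def coupling (x : ℝ) : ℝ :=
  ∑' j : ℕ, 1 / ((j : ℝ) + 1) ^ 2 * Real.cos (15 * ((j : ℝ) + 1) * x)

end HeatControl

end

open Filter Topology

noncomputable section

namespace HeatControl

/-! The mode `k₁ = 1` works. Suppose `y(T) = 0` and test with `e^{l² t} sin(l x)`, which solves the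
backward heat equation. The `y` integral disappears, and `l ∫ v e^{l² t}` equals minus the integral
of `α z e^{l² t} sin(l x)`. Since `z` carries only the frequency 1 and `α` shifts frequencies by
multiples of 15, only shifts of `l` that land on `±1` contribute (`hasSum_moment`). For `l = 15 n +
2` there are none, so the moment vanishes. For `l = 15 j + 1` exactly one remains, and the moment is
of size `e^{l² T}` divided by a power of `l`.

These requirements are incompatible (`no_moments`). By a quantitative Müntz estimate
(`abs_integral_mul_exp_le`), vanishing moments at `a ∈ M` force the moment at `b` below a constant
times `e^{bT} ∏ |b - a| / (b + a)`. With `b = l²`, the frequencies `15 n + 2` between `l / 2` and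
`l` make the product exponentially small in `l`, which beats any power of `l`.

Existence takes `z = e^{-t} w₁` and `y = ∑ yₙ(t) sin(n x)`, where `yₙ` solves the scalar equation of
mode `n`. Energy bounds give convergence in `L²` of space-time and, after one integration in `x`,
uniformly in time in `H⁻¹` (`exists_curve_of_sinCoeff`). The weak equation is then the sum of the
modal identities; the boundary term is recovered from `∂ₓφ(0) = (2/π) ∑ n φₙ`
(`hasSum_mul_sinCoeff`). -/

/-! ### Square integrable functions and Cauchy–Schwarz. -/

lemma integral_sq_eq_norm_sq {X : Type*} [MeasurableSpace X] {μ : Measure X} {f : X → ℝ}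
    (hf : MemLp f 2 μ) : ∫ x, f x ^ 2 ∂μ = ‖hf.toLp f‖ ^ 2 := by
  rw [← real_inner_self_eq_norm_sq, L2.inner_def]
  refine integral_congr_ae (hf.coeFn_toLp.mono fun x hx => ?_)
  simp [hx, sq]

lemma integral_mul_eq_inner {X : Type*} [MeasurableSpace X] {μ : Measure X} {f g : X → ℝ}
    (hf : MemLp f 2 μ) (hg : MemLp g 2 μ) :
    ∫ x, f x * g x ∂μ = inner ℝ (hf.toLp f) (hg.toLp g) := by
  rw [L2.inner_def]
  refine integral_congr_ae ?_
  filter_upwards [hf.coeFn_toLp, hg.coeFn_toLp] with x hx hy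
  simp [hx, hy, mul_comm]

/-- The Cauchy–Schwarz inequality for integrals. -/
lemma sq_integral_mul_le {X : Type*} [MeasurableSpace X] {μ : Measure X} {f g : X → ℝ}
    (hf : MemLp f 2 μ) (hg : MemLp g 2 μ) :
    (∫ x, f x * g x ∂μ) ^ 2 ≤ (∫ x, f x ^ 2 ∂μ) * ∫ x, g x ^ 2 ∂μ := by
  rw [integral_mul_eq_inner hf hg, integral_sq_eq_norm_sq hf, integral_sq_eq_norm_sq hg,
    ← mul_pow]
  exact sq_le_sq' (neg_le_of_abs_le (abs_real_inner_le_norm _ _)) (real_inner_le_norm _ _)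

lemma memLp_Ioo_of_continuousOn {f : ℝ → ℝ} {a b : ℝ} (hf : ContinuousOn f (Icc a b)) :
    MemLp f 2 (volume.restrict (Ioo a b)) := by
  obtain ⟨C, hC⟩ := isCompact_Icc.exists_bound_of_continuousOn hf
  refine MemLp.of_bound ((hf.mono Ioo_subset_Icc_self).aestronglyMeasurable measurableSet_Ioo) C ?_
  filter_upwards [ae_restrict_mem measurableSet_Ioo] with x hx
  exact hC x (Ioo_subset_Icc_self hx)

lemma setIntegral_Ioo_eq {f : ℝ → ℝ} {a b : ℝ} (hab : a ≤ b) :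
    ∫ x in Ioo a b, f x = ∫ x in a..b, f x := by
  rw [intervalIntegral.integral_of_le hab, integral_Ioc_eq_integral_Ioo]

/-! ### A quantitative Müntz estimate. -/

/-- The map `f ↦ f - 2 a h`, where `h' = f - a h` and `h(0) = 0`, does not increase the
`L²(0, T)` norm. -/
lemma integral_sq_sub_le {T a : ℝ} (ha : 0 ≤ a) {f h : ℝ → ℝ} (hf : Continuous f)
    (h0 : h 0 = 0) (hh : ∀ t, HasDerivAt h (f t - a * h t) t) :
    ∫ t in (0 : ℝ)..T, (f t - 2 * a * h t) ^ 2 ≤ ∫ t in (0 : ℝ)..T, f t ^ 2 := by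
  have hc : Continuous h := continuous_iff_continuousAt.2 fun t => (hh t).continuousAt
  -- The integrand is `4 a h (f - a h) = 4 a h h'`, an exact derivative.
  have key : ∫ t in (0 : ℝ)..T, (f t ^ 2 - (f t - 2 * a * h t) ^ 2)
      = 2 * a * h T ^ 2 - 2 * a * h 0 ^ 2 := by
    refine intervalIntegral.integral_eq_sub_of_hasDerivAt (f := fun t => 2 * a * h t ^ 2)
      (fun t _ => ?_) (Continuous.intervalIntegrable (by fun_prop) _ _)
    refine (((hh t).pow 2).const_mul (2 * a)).congr_deriv ?_
    norm_num
    ring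
  rw [intervalIntegral.integral_sub (Continuous.intervalIntegrable (by fun_prop) _ _)
    (Continuous.intervalIntegrable (by fun_prop) _ _), h0] at key
  nlinarith [mul_nonneg ha (sq_nonneg (h T))]

lemma hasDerivAt_exp_neg_mul (m t : ℝ) :
    HasDerivAt (fun t => Real.exp (-(m * t))) (-m * Real.exp (-(m * t))) t := by
  have := (((hasDerivAt_id t).const_mul m).neg).exp
  simpa [mul_comm] using this

/-- An exponential sum in which `e^{-b t}` has a large coefficient and whose `L²(0, T)` norm
is at most that of `e^{-b t}`. -/
lemma exists_expSum (T b : ℝ) (M : Finset ℝ) (hM : ∀ a ∈ M, 0 < a ∧ a ≠ b) :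
    ∃ c : ℝ → ℝ, ∫ t in (0 : ℝ)..T, ((∏ a ∈ M, (b + a) / (b - a)) * Real.exp (-(b * t))
        + ∑ a ∈ M, c a * Real.exp (-(a * t))) ^ 2
      ≤ ∫ t in (0 : ℝ)..T, Real.exp (-(b * t)) ^ 2 := by
  classical
  induction M using Finset.induction_on with
  | empty => exact ⟨0, by simp⟩
  | insert a M haM ih =>
    obtain ⟨c, hc⟩ := ih fun m hm => hM m (Finset.mem_insert_of_mem hm)
    obtain ⟨ha, hab⟩ := hM a (Finset.mem_insert_self _ _)
    set Q := ∏ a ∈ M, (b + a) / (b - a)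
    set f : ℝ → ℝ := fun t => Q * Real.exp (-(b * t)) + ∑ m ∈ M, c m * Real.exp (-(m * t))
    -- Convolution of `f` with `e^{-a t}`, written out term by term; it solves `h' = f - a h`, `h(0)
    -- = 0`.
    set h : ℝ → ℝ := fun t => Q / (a - b) * (Real.exp (-(b * t)) - Real.exp (-(a * t)))
      + ∑ m ∈ M, c m / (a - m) * (Real.exp (-(m * t)) - Real.exp (-(a * t))) with hdef
    have hne : ∀ m ∈ M, a - m ≠ 0 := fun m hm => by
      rw [sub_ne_zero]; rintro rfl; exact haM hm
    have hab' : a - b ≠ 0 := sub_ne_zero.2 hab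
    have hba' : b - a ≠ 0 := sub_ne_zero.2 hab.symm
    have hh : ∀ t, HasDerivAt h (f t - a * h t) t := fun t => by
      have h1 := ((hasDerivAt_exp_neg_mul b t).sub (hasDerivAt_exp_neg_mul a t)).const_mul
        (Q / (a - b))
      have h2 := HasDerivAt.fun_sum (u := M) fun m _ =>
        ((hasDerivAt_exp_neg_mul m t).sub (hasDerivAt_exp_neg_mul a t)).const_mul (c m / (a - m))
      refine (h1.add h2).congr_deriv ?_
      simp only [f, hdef, mul_add, Finset.mul_sum]
      rw [add_sub_add_comm, ← Finset.sum_sub_distrib]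
      congr 1
      · field_simp; ring
      · refine Finset.sum_congr rfl fun m hm => ?_
        have := hne m hm
        field_simp; ring
    have hle := integral_sq_sub_le (T := T) ha.le (f := f) (h := h) (by fun_prop)
      (by simp [hdef]) hh
    refine ⟨fun m => if m = a then 2 * a * (Q / (a - b) + ∑ m ∈ M, c m / (a - m))
      else c m * (1 - 2 * a / (a - m)), ?_⟩
    refine le_trans (le_of_eq ?_) (hle.trans hc)
    congr 1
    funext t
    congr 1
    beta_reduce
    rw [Finset.prod_insert haM, Finset.sum_insert haM, if_pos rfl]
    have e : ∑ m ∈ M, (if m = a then 2 * a * (Q / (a - b) + ∑ m ∈ M, c m / (a - m))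
        else c m * (1 - 2 * a / (a - m))) * Real.exp (-(m * t))
        = ∑ m ∈ M, c m * Real.exp (-(m * t)) - 2 * a * ∑ m ∈ M, c m / (a - m) *
          (Real.exp (-(m * t)) - Real.exp (-(a * t)))
          - 2 * a * (∑ m ∈ M, c m / (a - m)) * Real.exp (-(a * t)) := by
      rw [mul_assoc (2 * a), Finset.sum_mul, Finset.mul_sum, Finset.mul_sum,
        ← Finset.sum_sub_distrib, ← Finset.sum_sub_distrib]
      refine Finset.sum_congr rfl fun m hm => ?_
      rw [if_neg (by rintro rfl; exact haM hm)]
      have := hne m hm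
      field_simp; ring
    rw [e]
    simp only [f, hdef]
    -- The map `f ↦ f - 2 a h` has Laplace multiplier `(s - a) / (s + a)`, a Blaschke factor; its
    -- value at `s = -b` is the new factor of the product.
    have e3 : (b + a) / (b - a) = 1 - 2 * a / (a - b) := by
      field_simp; ring
    rw [e3]
    ring

/-- A quantitative Müntz theorem: a function orthogonal to the exponentials `e^{a t}`, `a ∈ M`,
is almost orthogonal to `e^{b t}`. -/
lemma abs_integral_mul_exp_le {T b : ℝ} (hT : 0 ≤ T) (hb : 0 ≤ b) {v : ℝ → ℝ}
    (hv : MemLp v 2 (volume.restrict (Ioo 0 T))) {M : Finset ℝ}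
    (hM : ∀ a ∈ M, 0 < a ∧ a ≠ b) (h0 : ∀ a ∈ M, ∫ t in Ioo 0 T, v t * Real.exp (a * t) = 0) :
    (∏ a ∈ M, |(b + a) / (b - a)|) * |∫ t in Ioo 0 T, v t * Real.exp (b * t)|
      ≤ Real.exp (b * T) * √((∫ t in Ioo 0 T, v t ^ 2) * T) := by
  obtain ⟨c, hc⟩ := exists_expSum T b M hM
  set Q := ∏ a ∈ M, (b + a) / (b - a)
  set g : ℝ → ℝ := fun t => Q * Real.exp (-(b * t)) + ∑ a ∈ M, c a * Real.exp (-(a * t))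
  have hg : Continuous g := by fun_prop
  have hint : ∀ {ξ : ℝ → ℝ}, Continuous ξ → Integrable (fun t => v t * ξ t)
      (volume.restrict (Ioo 0 T)) := fun hξ =>
    hv.integrable_mul (memLp_Ioo_of_continuousOn hξ.continuousOn)
  -- Time reversal turns the decaying exponentials of `g` into the growing ones of the moments, and
  -- `h0` removes all but `e^{b t}`.
  have e1 : ∫ t in Ioo 0 T, v t * g (T - t)
      = Q * Real.exp (-(b * T)) * ∫ t in Ioo 0 T, v t * Real.exp (b * t) := by
    have : ∀ t, v t * g (T - t) = Q * Real.exp (-(b * T)) * (v t * Real.exp (b * t))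
        + ∑ a ∈ M, c a * Real.exp (-(a * T)) * (v t * Real.exp (a * t)) := fun t => by
      simp only [g, mul_add, Finset.mul_sum]
      have ex : ∀ a : ℝ, Real.exp (-(a * (T - t))) = Real.exp (-(a * T)) * Real.exp (a * t) :=
        fun a => by rw [← Real.exp_add]; ring_nf
      simp only [ex]
      congr 1
      · ring
      · exact Finset.sum_congr rfl fun a _ => by ring
    simp only [this]
    rw [integral_add ((hint (by fun_prop)).const_mul _)
      (integrable_finsetSum _ fun a _ => (hint (by fun_prop)).const_mul _),
      integral_finsetSum _ fun a _ => (hint (by fun_prop)).const_mul _, integral_const_mul,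
      Finset.sum_eq_zero, add_zero]
    intro a ha
    rw [integral_const_mul, h0 a ha, mul_zero]
  have e2 : ∫ t in Ioo 0 T, g (T - t) ^ 2 ≤ T := by
    rw [setIntegral_Ioo_eq hT, intervalIntegral.integral_comp_sub_left (fun t => g t ^ 2),
      sub_self, sub_zero]
    refine hc.trans ?_
    have : ∫ t in (0 : ℝ)..T, Real.exp (-(b * t)) ^ 2 ≤ ∫ t in (0 : ℝ)..T, (1 : ℝ) := by
      refine intervalIntegral.integral_mono_on hT (Continuous.intervalIntegrable (by fun_prop) _ _)
        (by simp) fun t ht => ?_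
      have : Real.exp (-(b * t)) ≤ 1 := Real.exp_le_one_iff.2 (by nlinarith [ht.1])
      exact pow_le_one₀ (Real.exp_pos _).le this
    simpa using this
  have hcs := sq_integral_mul_le hv (memLp_Ioo_of_continuousOn (a := 0) (b := T)
    (f := fun t => g (T - t)) (by fun_prop))
  have h3 : |∫ t in Ioo 0 T, v t * g (T - t)| ≤ √((∫ t in Ioo 0 T, v t ^ 2) * T) := by
    apply Real.abs_le_sqrt
    exact hcs.trans (mul_le_mul_of_nonneg_left e2 (integral_nonneg fun _ => sq_nonneg _))
  rw [e1, abs_mul, abs_mul, Finset.abs_prod, Real.abs_exp] at h3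
  have h4 := mul_le_mul_of_nonneg_left h3 (Real.exp_pos (b * T)).le
  refine le_trans (le_of_eq ?_) h4
  have : Real.exp (b * T) * Real.exp (-(b * T)) = 1 := by rw [← Real.exp_add]; simp
  linear_combination (-(∏ a ∈ M, |(b + a) / (b - a)|) *
    |∫ t in Ioo 0 T, v t * Real.exp (b * t)|) * this

/-! ### Incompatibility of the moments. -/

/-- No square integrable function has the moments that a null control would need. -/
lemma no_moments {T κ : ℝ} (hT : 0 < T) (hκ : 0 < κ) {v : ℝ → ℝ}
    (hv : MemLp v 2 (volume.restrict (Ioo 0 T)))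
    (h0 : ∀ n : ℕ, ∫ t in Ioo 0 T, v t * Real.exp ((15 * n + 2) ^ 2 * t) = 0)
    (h1 : ∀ j : ℕ, 1 ≤ j → ∀ l : ℝ, l = 15 * j + 1 →
      l * ∫ t in Ioo 0 T, v t * Real.exp (l ^ 2 * t)
        = -(κ / j ^ 2 * ((Real.exp ((l ^ 2 - 1) * T) - 1) / (l ^ 2 - 1)))) : False := by
  set C := √((∫ t in Ioo 0 T, v t ^ 2) * T)
  -- A lower bound, uniform in `l² ≥ 2`, for `e^{-l² T} (e^{(l² - 1) T} - 1) = e^{-T} - e^{-l² T}`.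
  set δ := Real.exp (-T) - Real.exp (-(2 * T))
  have hδ : 0 < δ := sub_pos.2 (Real.exp_lt_exp.2 (by linarith))
  -- The moment at `l = 30 i + 1 ≤ 31 i`, that is `j = 2 i`, is estimated from both sides. The right
  -- side tends to 0 as `i → ∞`, while `κ δ > 0`.
  have main : ∀ i : ℕ, 1 ≤ i → κ * δ ≤ C * 31 ^ 5 * ((i : ℝ) ^ 5 * (3 / 5) ^ i) := by
    intro i hi
    have hi' : (1 : ℝ) ≤ i := by exact_mod_cast hi
    obtain ⟨l, hl⟩ : ∃ l : ℝ, l = 30 * i + 1 := ⟨_, rfl⟩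
    have hl0 : 31 ≤ l := by linarith
    have hl1 : l ≤ 31 * i := by linarith
    set I := ∫ t in Ioo 0 T, v t * Real.exp (l ^ 2 * t)
    have hI := h1 (2 * i) (by omega) l (by push_cast; linarith)
    -- Exactly `i` vanishing moments, at frequencies in `[l / 2, l)`.
    set M : Finset ℝ := (Finset.Ico i (2 * i)).image fun n : ℕ => (15 * (n : ℝ) + 2) ^ 2
    have hinj : Set.InjOn (fun n : ℕ => (15 * (n : ℝ) + 2) ^ 2) (Finset.Ico i (2 * i)) := by
      intro m _ n _ h
      have := (pow_left_inj₀ (by positivity) (by positivity) two_ne_zero).1 h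
      exact_mod_cast (by linarith : (m : ℝ) = n)
    have hn : ∀ n ∈ Finset.Ico i (2 * i), l / 2 ≤ 15 * (n : ℝ) + 2 ∧ 15 * (n : ℝ) + 2 < l := by
      intro n hn
      obtain ⟨ha, hb⟩ := Finset.mem_Ico.1 hn
      have ha' : (i : ℝ) ≤ n := by exact_mod_cast ha
      have hb' : (n : ℝ) + 1 ≤ 2 * i := by exact_mod_cast hb
      constructor <;> linarith
    have hmz := abs_integral_mul_exp_le (M := M) (b := l ^ 2) hT.le (sq_nonneg _) hv
      (by
        intro a ha
        obtain ⟨n, hn', rfl⟩ := Finset.mem_image.1 ha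
        have := hn n hn'
        exact ⟨by positivity, by nlinarith⟩)
      (by
        intro a ha
        obtain ⟨n, hn', rfl⟩ := Finset.mem_image.1 ha
        exact h0 n)
    rw [Finset.prod_image hinj] at hmz
    -- Each `a ∈ M` is at least `l² / 4`, so each factor is at least `(1 + 1/4) / (1 - 1/4) = 5/3`.
    have hprod : (5 / 3 : ℝ) ^ i ≤ ∏ n ∈ Finset.Ico i (2 * i),
        |(l ^ 2 + (15 * (n : ℝ) + 2) ^ 2) / (l ^ 2 - (15 * (n : ℝ) + 2) ^ 2)| := by
      have : (5 / 3 : ℝ) ^ i = ∏ n ∈ Finset.Ico i (2 * i), (5 / 3 : ℝ) := by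
        rw [Finset.prod_const, Nat.card_Ico]; congr 1; omega
      rw [this]
      refine Finset.prod_le_prod (fun _ _ => by norm_num) fun n hn' => ?_
      have := hn n hn'
      refine le_trans ?_ (le_abs_self _)
      rw [div_le_div_iff₀ (by norm_num) (by nlinarith)]
      nlinarith
    have h5 : (5 / 3 : ℝ) ^ i * |I| ≤ Real.exp (l ^ 2 * T) * C :=
      (mul_le_mul_of_nonneg_right hprod (abs_nonneg _)).trans hmz
    have h6 : κ * δ * Real.exp (l ^ 2 * T) ≤ l ^ 5 * |I| := by
      have hl2 : 0 < l ^ 2 - 1 := by nlinarith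
      have e1 : Real.exp (l ^ 2 * T) * δ ≤ Real.exp ((l ^ 2 - 1) * T) - 1 := by
        have : Real.exp ((l ^ 2 - 1) * T) - 1
            = Real.exp (l ^ 2 * T) * (Real.exp (-T) - Real.exp (-(l ^ 2 * T))) := by
          rw [mul_sub, ← Real.exp_add, ← Real.exp_add]; simp; ring_nf
        rw [this]
        refine mul_le_mul_of_nonneg_left (sub_le_sub_left (Real.exp_le_exp.2 ?_) _)
          (Real.exp_pos _).le
        have : (2 : ℝ) ≤ l ^ 2 := by nlinarith
        nlinarith
      have e2 : l * |I| = κ / ((2 * i : ℕ) : ℝ) ^ 2 *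
          ((Real.exp ((l ^ 2 - 1) * T) - 1) / (l ^ 2 - 1)) := by
        have hpos : 0 ≤ κ / ((2 * i : ℕ) : ℝ) ^ 2 *
          ((Real.exp ((l ^ 2 - 1) * T) - 1) / (l ^ 2 - 1)) := by
          have : 0 ≤ Real.exp ((l ^ 2 - 1) * T) - 1 := le_trans (by positivity) e1
          positivity
        rw [← abs_of_pos (by linarith : 0 < l), ← abs_mul, abs_of_pos (by linarith : 0 < l), hI,
          abs_neg, abs_of_nonneg hpos]
      have e3 : κ * δ * Real.exp (l ^ 2 * T) ≤ l * |I| * (((2 * i : ℕ) : ℝ) ^ 2 * (l ^ 2 - 1)) := by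
        rw [e2]
        have : κ / ((2 * i : ℕ) : ℝ) ^ 2 * ((Real.exp ((l ^ 2 - 1) * T) - 1) / (l ^ 2 - 1))
          * (((2 * i : ℕ) : ℝ) ^ 2 * (l ^ 2 - 1)) = κ * (Real.exp ((l ^ 2 - 1) * T) - 1) := by
          have : ((2 * i : ℕ) : ℝ) ≠ 0 := by positivity
          field_simp
        rw [this]
        nlinarith
      refine e3.trans ?_
      have e4 : ((2 * i : ℕ) : ℝ) ^ 2 * (l ^ 2 - 1) ≤ l ^ 2 * l ^ 2 := by
        push_cast
        refine mul_le_mul (by gcongr; linarith) (by linarith) hl2.le (by positivity)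
      calc _ ≤ l * |I| * (l ^ 2 * l ^ 2) := by gcongr
        _ = _ := by ring
    have h7 : κ * δ * (5 / 3 : ℝ) ^ i ≤ l ^ 5 * C := by
      refine le_of_mul_le_mul_right ?_ (Real.exp_pos (l ^ 2 * T))
      calc κ * δ * (5 / 3 : ℝ) ^ i * Real.exp (l ^ 2 * T)
          = κ * δ * Real.exp (l ^ 2 * T) * (5 / 3 : ℝ) ^ i := by ring
        _ ≤ l ^ 5 * |I| * (5 / 3 : ℝ) ^ i := by gcongr
        _ = l ^ 5 * ((5 / 3 : ℝ) ^ i * |I|) := by ring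
        _ ≤ l ^ 5 * (Real.exp (l ^ 2 * T) * C) := by gcongr
        _ = _ := by ring
    have e5 : (5 / 3 : ℝ) ^ i * (3 / 5) ^ i = 1 := by rw [← mul_pow]; norm_num
    calc κ * δ = κ * δ * (5 / 3 : ℝ) ^ i * (3 / 5) ^ i := by rw [mul_assoc, e5, mul_one]
      _ ≤ l ^ 5 * C * (3 / 5) ^ i := by gcongr
      _ ≤ (31 * i) ^ 5 * C * (3 / 5) ^ i := by
        have : 0 ≤ C := Real.sqrt_nonneg _
        gcongr
      _ = _ := by ring
  have hlim : Tendsto (fun i : ℕ => C * 31 ^ 5 * ((i : ℝ) ^ 5 * (3 / 5) ^ i)) atTop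
      (𝓝 (C * 31 ^ 5 * 0)) :=
    (tendsto_pow_const_mul_const_pow_of_lt_one 5 (by norm_num) (by norm_num)).const_mul _
  have := ge_of_tendsto hlim (eventually_atTop.2 ⟨1, main⟩)
  rw [mul_zero] at this
  exact absurd this (not_le.2 (by positivity))

/-! ### Exponential-sine test functions and their pairing with `w 1`. -/

/-- The function `e^{c t} sin(p x)`. -/
def TestFunction.expSin (c : ℝ) (p : ℤ) : TestFunction where
  toFun x t := Real.exp (c * t) * Real.sin (p * x)
  smooth := by fun_prop
  left t := by simp
  right t := by simp [Real.sin_int_mul_pi]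

lemma TestFunction.expSin_apply (c : ℝ) (p : ℤ) (x t : ℝ) :
    (expSin c p).toFun x t = Real.exp (c * t) * Real.sin (p * x) := rfl

lemma deriv_sin_mul (p : ℝ) : deriv (fun x => Real.sin (p * x)) = fun x => p * Real.cos (p * x) := by
  funext x
  have := ((hasDerivAt_id x).const_mul p).sin
  simpa [mul_comm] using this.deriv

lemma deriv_cos_mul (p : ℝ) :
    deriv (fun x => Real.cos (p * x)) = fun x => -(p * Real.sin (p * x)) := by
  funext x
  have := ((hasDerivAt_id x).const_mul p).cos
  simpa [mul_comm] using this.deriv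

lemma TestFunction.expSin_dt (c : ℝ) (p : ℤ) (x t : ℝ) :
    (expSin c p).dt x t = c * (Real.exp (c * t) * Real.sin (p * x)) := by
  have := (((hasDerivAt_id t).const_mul c).exp).mul_const (Real.sin (p * x))
  simp only [dt, expSin_apply]
  simpa [mul_comm, mul_assoc, mul_left_comm] using this.deriv

lemma TestFunction.expSin_dx (c : ℝ) (p : ℤ) (t : ℝ) :
    (expSin c p).dx 0 t = p * Real.exp (c * t) := by
  simp only [dx, expSin_apply]
  rw [deriv_const_mul_field, deriv_sin_mul]
  simp [mul_comm]

lemma TestFunction.expSin_dxx (c : ℝ) (p : ℤ) (x t : ℝ) :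
    (expSin c p).dxx x t = -(p : ℝ) ^ 2 * (Real.exp (c * t) * Real.sin (p * x)) := by
  simp only [dxx, expSin_apply]
  rw [iteratedDeriv_succ, iteratedDeriv_one]
  have : deriv (fun ξ => Real.exp (c * t) * Real.sin (p * ξ))
      = fun ξ => Real.exp (c * t) * (p * Real.cos (p * ξ)) := by
    funext ξ
    rw [deriv_const_mul_field, deriv_sin_mul]
  rw [this, deriv_const_mul_field, deriv_const_mul_field, deriv_cos_mul]
  ring

lemma toL2_const_mul {f g : ℝ → ℝ} (hf : Continuous f) (hg : Continuous g) {c : ℝ}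
    (h : ∀ x, g x = c * f x) : toL2 g hg = c • toL2 f hf := by
  have : g = c • f := funext h
  subst this
  exact MemLp.toLp_const_smul c (memLp_of_continuous hf)

/-- All slices are multiples of one element of `H10`, so each functional enters through a single
number per frequency `p`. -/
lemma TestFunction.expSin_slice (c : ℝ) (p : ℤ) (t : ℝ) :
    (expSin c p).slice t = Real.exp (c * t) • (expSin 0 p).slice 0 := by
  have hd : ∀ c t : ℝ, deriv (fun x => (expSin c p).toFun x t)
      = fun x => Real.exp (c * t) * (p * Real.cos (p * x)) := fun c t => by
    funext x
    simp only [expSin_apply]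
    rw [deriv_const_mul_field, deriv_sin_mul]
  refine Subtype.ext ?_
  change WithLp.toLp 2 (_, _) = Real.exp (c * t) • WithLp.toLp 2 (_, _)
  rw [← WithLp.toLp_smul, Prod.smul_mk]
  congr 2
  · exact toL2_const_mul _ _ fun x => by simp [expSin_apply]
  · exact toL2_const_mul _ _ fun x => by simp [hd]

lemma toHneg1_apply (f : L2) (u : H10) : L2.toHneg1 f u = inner ℝ f u.1.fst := rfl

lemma inner_toL2 {f g : ℝ → ℝ} (hf : Continuous f) (hg : Continuous g) :
    inner ℝ (toL2 f hf) (toL2 g hg) = ∫ x in (0 : ℝ)..π, f x * g x := by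
  rw [toL2, toL2, ← integral_mul_eq_inner (memLp_of_continuous hf) (memLp_of_continuous hg),
    setIntegral_Ioo_eq Real.pi_pos.le]

lemma integral_cos_int_mul {k : ℤ} (hk : k ≠ 0) : ∫ x in (0 : ℝ)..π, Real.cos (k * x) = 0 := by
  rw [intervalIntegral.integral_comp_mul_left Real.cos (Int.cast_ne_zero.2 hk)]
  simp [Real.sin_int_mul_pi]

lemma integral_cos_mul_cos {m n : ℤ} (h1 : m ≠ n) (h2 : m ≠ -n) :
    ∫ x in (0 : ℝ)..π, Real.cos (m * x) * Real.cos (n * x) = 0 := by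
  have : ∀ x : ℝ, Real.cos (m * x) * Real.cos (n * x)
      = 1 / 2 * Real.cos ((m - n : ℤ) * x) + 1 / 2 * Real.cos ((m + n : ℤ) * x) := fun x => by
    push_cast; rw [sub_mul, add_mul, Real.cos_sub, Real.cos_add]; ring
  simp only [this]
  rw [intervalIntegral.integral_add (Continuous.intervalIntegrable (by fun_prop) _ _)
    (Continuous.intervalIntegrable (by fun_prop) _ _), intervalIntegral.integral_const_mul,
    intervalIntegral.integral_const_mul, integral_cos_int_mul (by omega),
    integral_cos_int_mul (by omega)]
  simp

lemma integral_sin_mul_sin {m n : ℤ} (h1 : m ≠ n) (h2 : m ≠ -n) :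
    ∫ x in (0 : ℝ)..π, Real.sin (m * x) * Real.sin (n * x) = 0 := by
  have : ∀ x : ℝ, Real.sin (m * x) * Real.sin (n * x)
      = 1 / 2 * Real.cos ((m - n : ℤ) * x) - 1 / 2 * Real.cos ((m + n : ℤ) * x) := fun x => by
    push_cast; rw [sub_mul, add_mul, Real.cos_sub, Real.cos_add]; ring
  simp only [this]
  rw [intervalIntegral.integral_sub (Continuous.intervalIntegrable (by fun_prop) _ _)
    (Continuous.intervalIntegrable (by fun_prop) _ _), intervalIntegral.integral_const_mul,
    intervalIntegral.integral_const_mul, integral_cos_int_mul (by omega),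
    integral_cos_int_mul (by omega)]
  simp

lemma TestFunction.continuous_left (φ : TestFunction) (t : ℝ) : Continuous fun x => φ.toFun x t :=
  φ.smooth.continuous.comp (by fun_prop : Continuous fun x : ℝ => (x, t))

lemma w_one_apply_slice {p : ℤ} (h1 : 1 ≠ p) (h2 : 1 ≠ -p) (c t : ℝ) :
    w 1 ((TestFunction.expSin c p).slice t) = 0 := by
  rw [TestFunction.expSin_slice, map_smul]
  have : w 1 ((TestFunction.expSin 0 p).slice 0) = 0 := by
    rw [w, toHneg1_apply]
    refine (inner_toL2 _ (TestFunction.continuous_left _ _)).trans ?_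
    have := integral_sin_mul_sin h1 h2
    simp only [eigenfunction, TestFunction.expSin_apply, mul_assoc]
    simpa using Or.inr this
  rw [this, smul_zero]

lemma w_one_apply_slice_one (c t : ℝ) :
    w 1 ((TestFunction.expSin c 1).slice t) = Real.exp (c * t) * (√(2 / π) * (π / 2)) := by
  rw [TestFunction.expSin_slice, map_smul]
  have : w 1 ((TestFunction.expSin 0 1).slice 0) = √(2 / π) * (π / 2) := by
    rw [w, toHneg1_apply]
    refine (inner_toL2 _ (TestFunction.continuous_left _ _)).trans ?_
    have := integral_sin_sq (a := 0) (b := π)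
    simp only [eigenfunction, TestFunction.expSin_apply, mul_assoc]
    simp [sq] at this
    simpa using Or.inl this
  rw [this, smul_eq_mul]

/-! ### The series of the coupling coefficient and the moments of a null control. -/

lemma abs_coupling_term_le (j : ℕ) (x : ℝ) :
    ‖1 / ((j : ℝ) + 1) ^ 2 * Real.cos (15 * ((j : ℝ) + 1) * x)‖ ≤ 1 / ((j : ℝ) + 1) ^ 2 := by
  rw [norm_mul, Real.norm_of_nonneg (by positivity : (0 : ℝ) ≤ 1 / ((j : ℝ) + 1) ^ 2)]
  exact mul_le_of_le_one_right (by positivity) (Real.abs_cos_le_one _)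

lemma summable_one_div_succ_sq : Summable fun j : ℕ => 1 / ((j : ℝ) + 1) ^ 2 := by
  have := (summable_nat_add_iff 1).2 (Real.summable_one_div_nat_pow.2 one_lt_two)
  simpa using this

lemma hasSum_coupling (x : ℝ) :
    HasSum (fun j : ℕ => 1 / ((j : ℝ) + 1) ^ 2 * Real.cos (15 * ((j : ℝ) + 1) * x))
      (coupling x) :=
  (Summable.of_norm_bounded summable_one_div_succ_sq fun j => abs_coupling_term_le j x).hasSum

/-- Integration of `α g` term by term. -/
lemma hasSum_integral_coupling_mul {μ : Measure (ℝ × ℝ)} {g : ℝ × ℝ → ℝ} (hg : Integrable g μ) :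
    HasSum (fun j : ℕ => ∫ q, 1 / ((j : ℝ) + 1) ^ 2 * Real.cos (15 * ((j : ℝ) + 1) * q.1) * g q ∂μ)
      (∫ q, coupling q.1 * g q ∂μ) := by
  have hb : ∀ j : ℕ, ∀ q, ‖1 / ((j : ℝ) + 1) ^ 2 * Real.cos (15 * ((j : ℝ) + 1) * q.1) * g q‖
      ≤ 1 / ((j : ℝ) + 1) ^ 2 * ‖g q‖ := fun j q => by
    rw [norm_mul]
    exact mul_le_mul_of_nonneg_right (abs_coupling_term_le j q.1) (norm_nonneg _)
  have hi : ∀ j : ℕ, Integrable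
      (fun q => 1 / ((j : ℝ) + 1) ^ 2 * Real.cos (15 * ((j : ℝ) + 1) * q.1) * g q) μ := fun j =>
    (hg.norm.const_mul _).mono' ((Continuous.aestronglyMeasurable (by fun_prop)).mul hg.1)
      (ae_of_all _ (hb j))
  have := hasSum_integral_of_summable_integral_norm hi
    (Summable.of_nonneg_of_le (fun j => integral_nonneg fun _ => norm_nonneg _)
      (fun j => integral_mono (hi j).norm (hg.norm.const_mul _) (hb j))
      (by simp only [integral_const_mul]; exact summable_one_div_succ_sq.mul_right _))
  rw [show ∫ q, coupling q.1 * g q ∂μ = ∫ q, ∑' j : ℕ,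
      1 / ((j : ℝ) + 1) ^ 2 * Real.cos (15 * ((j : ℝ) + 1) * q.1) * g q ∂μ from
    integral_congr_ae (ae_of_all _ fun q => ((hasSum_coupling q.1).mul_right (g q)).tsum_eq.symm)]
  exact this

lemma memLp_prod_of_continuous {T : ℝ} {f : ℝ × ℝ → ℝ} (hf : Continuous f) :
    MemLp f 2 (volume.restrict (Ioo 0 π ×ˢ Ioo 0 T)) := by
  obtain ⟨C, hC⟩ := (isCompact_Icc.prod isCompact_Icc).exists_bound_of_continuousOn
    (s := Icc 0 π ×ˢ Icc 0 T) hf.continuousOn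
  have : IsFiniteMeasure (volume.restrict (Ioo (0 : ℝ) π ×ˢ Ioo 0 T)) := by
    refine ⟨?_⟩
    rw [Measure.restrict_apply_univ, Measure.volume_eq_prod, Measure.prod_prod]
    simpa using ENNReal.mul_lt_top ENNReal.ofReal_lt_top ENNReal.ofReal_lt_top
  refine MemLp.of_bound hf.aestronglyMeasurable C ?_
  filter_upwards [ae_restrict_mem (measurableSet_Ioo.prod measurableSet_Ioo)] with x hx
  exact hC x (Set.prod_mono Ioo_subset_Icc_self Ioo_subset_Icc_self hx)

/-- The weak equation of `z` is tested with exponent `c` and with exponent `p²`. The second kills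
the integral and determines `Z T` on `sin(p x)`, which is then eliminated from the first. Hence `z`
is never identified pointwise and no uniqueness theorem is needed. -/
lemma integral_mul_expSin {T : ℝ} (hT : 0 ≤ T) {z₀ : Hneg1} {v : ℝ → ℝ} {α : ℝ → ℝ} {y₀ : Hneg1}
    {y z : ℝ × ℝ → ℝ} {Y Z : ℝ → Hneg1} (h : IsTranspositionSolution T α y₀ z₀ v y z Y Z)
    (c : ℝ) (p : ℤ) (hc : c ≠ (p : ℝ) ^ 2) :
    ∫ q in Ioo 0 π ×ˢ Ioo 0 T, z q * (Real.exp (c * q.2) * Real.sin (p * q.1))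
      = z₀ ((TestFunction.expSin 0 p).slice 0)
        * ((Real.exp ((c - (p : ℝ) ^ 2) * T) - 1) / (c - (p : ℝ) ^ 2)) := by
  have key : ∀ c : ℝ, Real.exp (c * T) * Z T ((TestFunction.expSin 0 p).slice 0)
      - z₀ ((TestFunction.expSin 0 p).slice 0) = (c - (p : ℝ) ^ 2) *
        ∫ q in Ioo 0 π ×ˢ Ioo 0 T, z q * (Real.exp (c * q.2) * Real.sin (p * q.1)) := fun c => by
    have := h.eq_z T ⟨hT, le_rfl⟩ (TestFunction.expSin c p)
    rw [TestFunction.expSin_slice, TestFunction.expSin_slice c p 0, map_smul, map_smul] at this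
    simp only [mul_zero, Real.exp_zero, smul_eq_mul, one_mul] at this
    rw [this, ← integral_const_mul]
    congr 1
    funext q
    rw [TestFunction.expSin_dt, TestFunction.expSin_dxx]
    ring
  have h1 := key c
  have h2 := key ((p : ℝ) ^ 2)
  have hne : c - (p : ℝ) ^ 2 ≠ 0 := sub_ne_zero.2 hc
  have e : Real.exp (c * T) = Real.exp ((c - (p : ℝ) ^ 2) * T) * Real.exp ((p : ℝ) ^ 2 * T) := by
    rw [← Real.exp_add]; ring_nf
  rw [sub_self, zero_mul] at h2
  rw [← mul_div_assoc, eq_div_iff hne, mul_comm, ← h1, e]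
  linear_combination Real.exp ((c - (p : ℝ) ^ 2) * T) * h2

/-- The moments of a control that steers `(0, w₁)` to a pair with vanishing first component. -/
lemma hasSum_moment {T : ℝ} (hT : 0 ≤ T) {v : ℝ → ℝ}
    {y z : ℝ × ℝ → ℝ} {Y Z : ℝ → Hneg1} (h : IsTranspositionSolution T coupling 0 (w 1) v y z Y Z)
    (hY : Y T = 0) (l : ℤ) (hl : ∀ j : ℕ, 2 * l ≠ 15 * (j + 1))
    (hl' : ∀ j : ℕ, 2 * l ≠ -(15 * (j + 1))) :
    HasSum (fun j : ℕ => 1 / (2 * ((j : ℝ) + 1) ^ 2) *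
      (w 1 ((TestFunction.expSin 0 (l + 15 * (j + 1))).slice 0)
        * ((Real.exp (((l : ℝ) ^ 2 - ((l + 15 * (j + 1) : ℤ) : ℝ) ^ 2) * T) - 1)
          / ((l : ℝ) ^ 2 - ((l + 15 * (j + 1) : ℤ) : ℝ) ^ 2))
      + w 1 ((TestFunction.expSin 0 (l - 15 * (j + 1))).slice 0)
        * ((Real.exp (((l : ℝ) ^ 2 - ((l - 15 * (j + 1) : ℤ) : ℝ) ^ 2) * T) - 1)
          / ((l : ℝ) ^ 2 - ((l - 15 * (j + 1) : ℤ) : ℝ) ^ 2))))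
      (-(l * ∫ t in Ioo 0 T, v t * Real.exp ((l : ℝ) ^ 2 * t))) := by
  have hint : ∀ {ξ : ℝ × ℝ → ℝ}, Continuous ξ → Integrable (fun q => z q * ξ q)
      (volume.restrict (Ioo 0 π ×ˢ Ioo 0 T)) := fun hξ =>
    h.rep_z.memLp.integrable_mul (memLp_prod_of_continuous hξ)
  -- The exponent `l²` makes `∂ₜφ + ∂ₓₓφ = 0`, so `y` survives only through `Y T = 0`.
  have h1 := h.eq_y T ⟨hT, le_rfl⟩ (TestFunction.expSin ((l : ℝ) ^ 2) l)
  have e1 : ∀ q : ℝ × ℝ, y q * ((TestFunction.expSin ((l : ℝ) ^ 2) l).dt q.1 q.2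
        + (TestFunction.expSin ((l : ℝ) ^ 2) l).dxx q.1 q.2)
        + coupling q.1 * z q * (TestFunction.expSin ((l : ℝ) ^ 2) l).toFun q.1 q.2
      = coupling q.1 * (z q * (Real.exp ((l : ℝ) ^ 2 * q.2) * Real.sin (l * q.1))) := fun q => by
    rw [TestFunction.expSin_dt, TestFunction.expSin_dxx, TestFunction.expSin_apply]; ring
  have e2 : ∀ t, v t * (TestFunction.expSin ((l : ℝ) ^ 2) l).dx 0 t
      = l * (v t * Real.exp ((l : ℝ) ^ 2 * t)) := fun t => by
    rw [TestFunction.expSin_dx]; ring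
  simp only [e1, e2, hY, zero_apply, sub_zero] at h1
  rw [integral_const_mul] at h1
  rw [show -(l * ∫ t in Ioo 0 T, v t * Real.exp ((l : ℝ) ^ 2 * t))
    = ∫ q in Ioo 0 π ×ˢ Ioo 0 T, coupling q.1 *
      (z q * (Real.exp ((l : ℝ) ^ 2 * q.2) * Real.sin (l * q.1))) by linarith]
  convert hasSum_integral_coupling_mul (hint (by fun_prop :
    Continuous fun q : ℝ × ℝ => Real.exp ((l : ℝ) ^ 2 * q.2) * Real.sin (l * q.1))) using 1
  funext j
  -- No shifted frequency is `±l`, which keeps the denominators nonzero; the hypotheses on `2 * l`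
  -- exclude the sign `-`.
  have hp : (l : ℝ) ^ 2 ≠ ((l + 15 * (j + 1) : ℤ) : ℝ) ^ 2 := by
    intro hh
    have hh' : l ^ 2 = (l + 15 * (j + 1)) ^ 2 := by exact_mod_cast hh
    rcases sq_eq_sq_iff_eq_or_eq_neg.1 hh' with h | h
    · omega
    · exact hl' j (by linarith)
  have hm : (l : ℝ) ^ 2 ≠ ((l - 15 * (j + 1) : ℤ) : ℝ) ^ 2 := by
    intro hh
    have hh' : l ^ 2 = (l - 15 * (j + 1)) ^ 2 := by exact_mod_cast hh
    rcases sq_eq_sq_iff_eq_or_eq_neg.1 hh' with h | h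
    · omega
    · exact hl j (by linarith)
  rw [← integral_mul_expSin hT h _ _ hp, ← integral_mul_expSin hT h _ _ hm,
    ← integral_add (hint (by fun_prop)) (hint (by fun_prop)), ← integral_const_mul]
  congr 1
  funext q
  push_cast
  rw [show (l + 15 * ((j : ℝ) + 1)) * q.1 = l * q.1 + 15 * ((j : ℝ) + 1) * q.1 by ring,
    show (l - 15 * ((j : ℝ) + 1)) * q.1 = l * q.1 - 15 * ((j : ℝ) + 1) * q.1 by ring,
    Real.sin_add, Real.sin_sub]
  field_simp
  ring

/-- The datum `(0, w₁)` cannot be steered to a pair with vanishing first component. -/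
theorem apply_ne_zero_of_isTranspositionSolution {T : ℝ} (hT : 0 < T) {v : ℝ → ℝ}
    (hv : MemLp v 2 (volume.restrict (Ioo 0 T)))
    {y z : ℝ × ℝ → ℝ} {Y Z : ℝ → Hneg1}
    (h : IsTranspositionSolution T coupling 0 (w 1) v y z Y Z) : Y T ≠ 0 := by
  intro hY
  -- `√(2/π) · π/2` is the pairing of `w 1` with `sin x`; the further `1/2` comes from the
  -- product-to-sum formula.
  have hκ : 0 < √(2 / π) * (π / 2) / 2 := by positivity
  refine no_moments hT hκ hv (fun n => ?_) (fun j hj l hl => ?_)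
  -- Modulo 15 every shifted frequency is 2, never `±1`, so all terms vanish.
  · have := hasSum_moment hT.le h hY (15 * n + 2) (fun j => by omega) (fun j => by omega)
    have h0 : (-(((15 * n + 2 : ℤ) : ℝ) *
        ∫ t in Ioo 0 T, v t * Real.exp (((15 * n + 2 : ℤ) : ℝ) ^ 2 * t))) = 0 := by
      refine this.unique ?_
      convert hasSum_zero using 2 with j
      rw [w_one_apply_slice (by omega) (by omega), w_one_apply_slice (by omega) (by omega)]
      ring
    have h2 : ((15 * n + 2 : ℤ) : ℝ) ≠ 0 := by positivity
    have h3 := (mul_eq_zero.1 (neg_eq_zero.1 h0)).resolve_left h2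
    push_cast at h3
    exact h3
  · obtain ⟨i, rfl⟩ : ∃ i, j = i + 1 := ⟨j - 1, by omega⟩
    have := hasSum_moment hT.le h hY (15 * (i + 1) + 1) (fun j => by omega) (fun j => by omega)
    -- Shifted frequencies are 1 modulo 15, so `-1` does not occur; the value 1 occurs only for the
    -- downward shift with `j = i`.
    have h2 := this.unique (hasSum_single i fun j hj => by
      rw [w_one_apply_slice (by omega) (by omega), w_one_apply_slice (by omega) (by omega)]
      ring)
    rw [w_one_apply_slice (by omega) (by omega),
      show (15 * (i + 1 : ℤ) + 1 - 15 * (i + 1)) = 1 by ring, w_one_apply_slice_one] at h2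
    have hl' : ((15 * (i + 1) + 1 : ℤ) : ℝ) = l := by rw [hl]; push_cast; ring
    rw [hl'] at h2
    rw [← neg_eq_iff_eq_neg, h2]
    simp
    field_simp

/-! ### Sine coefficients and the derivative at the endpoint. -/

/-- The Fourier series of the second Bernoulli polynomial at `x / (2π)`. The term `n = 0` is zero
because `1 / 0 = 0`. -/
lemma hasSum_cos_div_sq {x : ℝ} (hx : x ∈ Icc 0 π) :
    HasSum (fun n : ℕ => 1 / (n : ℝ) ^ 2 * Real.cos (n * x)) (π ^ 2 / 6 - π * x / 2 + x ^ 2 / 4) := by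
  have hpi := Real.pi_pos
  have h := hasSum_one_div_nat_pow_mul_cos one_ne_zero (x := x / (2 * π))
    ⟨by have := hx.1; positivity, by rw [div_le_one (by positivity)]; linarith [hx.2]⟩
  have e1 : ∀ n : ℕ, Real.cos (2 * π * n * (x / (2 * π))) = Real.cos (n * x) := fun n => by
    congr 1; field_simp
  simp only [e1, mul_one] at h
  convert h using 1
  rw [Polynomial.bernoulli]
  simp [Finset.sum_range_succ, bernoulli_eq_bernoulli'_of_ne_one, bernoulli'_two]
  field_simp
  ring

/-- A continuously differentiable chain `u, u', u'', u'''` on `ℝ`, with `u` vanishing at `0`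
and `π`. -/
structure DerivChain (u u₁ u₂ u₃ : ℝ → ℝ) : Prop where
  deriv₁ : ∀ x, HasDerivAt u (u₁ x) x
  deriv₂ : ∀ x, HasDerivAt u₁ (u₂ x) x
  deriv₃ : ∀ x, HasDerivAt u₂ (u₃ x) x
  continuous₃ : Continuous u₃
  left : u 0 = 0
  right : u π = 0

namespace DerivChain

variable {u u₁ u₂ u₃ : ℝ → ℝ}

lemma continuous₁ (h : DerivChain u u₁ u₂ u₃) : Continuous u₁ :=
  continuous_iff_continuousAt.2 fun x => (h.deriv₂ x).continuousAt

lemma continuous₂ (h : DerivChain u u₁ u₂ u₃) : Continuous u₂ :=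
  continuous_iff_continuousAt.2 fun x => (h.deriv₃ x).continuousAt

end DerivChain

lemma hasDerivAt_sin_mul (p x : ℝ) :
    HasDerivAt (fun x => Real.sin (p * x)) (p * Real.cos (p * x)) x := by
  simpa [mul_comm] using ((hasDerivAt_id x).const_mul p).sin

lemma hasDerivAt_cos_mul (p x : ℝ) :
    HasDerivAt (fun x => Real.cos (p * x)) (-(p * Real.sin (p * x))) x := by
  simpa [mul_comm] using ((hasDerivAt_id x).const_mul p).cos

lemma mul_integral_mul_sin {u u₁ : ℝ → ℝ} (hu : ∀ x, HasDerivAt u (u₁ x) x) (h₁ : Continuous u₁)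
    (p : ℝ) : p * ∫ x in (0 : ℝ)..π, u x * Real.sin (p * x)
      = u 0 - u π * Real.cos (p * π) + ∫ x in (0 : ℝ)..π, u₁ x * Real.cos (p * x) := by
  have hc : Continuous u := continuous_iff_continuousAt.2 fun x => (hu x).continuousAt
  have := intervalIntegral.integral_eq_sub_of_hasDerivAt (a := 0) (b := π)
    (f := fun x => u x * Real.cos (p * x))
    (fun x _ => (hu x).mul (hasDerivAt_cos_mul p x))
    (Continuous.intervalIntegrable (by fun_prop) _ _)
  rw [intervalIntegral.integral_add (Continuous.intervalIntegrable (by fun_prop) _ _)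
    (Continuous.intervalIntegrable (by fun_prop) _ _)] at this
  have e : ∫ x in (0 : ℝ)..π, u x * -(p * Real.sin (p * x))
      = -(p * ∫ x in (0 : ℝ)..π, u x * Real.sin (p * x)) := by
    rw [← intervalIntegral.integral_const_mul, ← intervalIntegral.integral_neg]
    congr 1; funext x; ring
  rw [e] at this
  simp only [mul_zero, Real.cos_zero, mul_one] at this
  linarith

lemma mul_integral_mul_cos {u u₁ : ℝ → ℝ} (hu : ∀ x, HasDerivAt u (u₁ x) x) (h₁ : Continuous u₁)
    (n : ℕ) : n * ∫ x in (0 : ℝ)..π, u x * Real.cos (n * x)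
      = -∫ x in (0 : ℝ)..π, u₁ x * Real.sin (n * x) := by
  have hc : Continuous u := continuous_iff_continuousAt.2 fun x => (hu x).continuousAt
  have := intervalIntegral.integral_eq_sub_of_hasDerivAt (a := 0) (b := π)
    (f := fun x => u x * Real.sin (n * x))
    (fun x _ => (hu x).mul (hasDerivAt_sin_mul n x))
    (Continuous.intervalIntegrable (by fun_prop) _ _)
  rw [intervalIntegral.integral_add (Continuous.intervalIntegrable (by fun_prop) _ _)
    (Continuous.intervalIntegrable (by fun_prop) _ _)] at this
  have e : ∫ x in (0 : ℝ)..π, u x * (n * Real.cos (n * x))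
      = n * ∫ x in (0 : ℝ)..π, u x * Real.cos (n * x) := by
    rw [← intervalIntegral.integral_const_mul]
    congr 1; funext x; ring
  rw [e] at this
  simp only [mul_zero, Real.sin_zero, Real.sin_nat_mul_pi] at this
  linarith

namespace DerivChain

variable {u u₁ u₂ u₃ : ℝ → ℝ}

lemma integral_deriv₂_mul_sin (h : DerivChain u u₁ u₂ u₃) (n : ℕ) :
    ∫ x in (0 : ℝ)..π, u₂ x * Real.sin (n * x)
      = -(n : ℝ) ^ 2 * ∫ x in (0 : ℝ)..π, u x * Real.sin (n * x) := by
  have h1 := mul_integral_mul_sin h.deriv₁ h.continuous₁ n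
  have h2 := mul_integral_mul_cos h.deriv₂ h.continuous₂ n
  rw [h.left, h.right] at h1
  linear_combination h2 + n * h1

/-- Three integrations by parts. The boundary terms keep the shape `cos(n x) / n²` at `x = π` and `x
= 0`, so that all three parts are summed by `hasSum_cos_div_sq`. -/
lemma mul_sinCoeff_eq (h : DerivChain u u₁ u₂ u₃) (n : ℕ) :
    n * ∫ x in (0 : ℝ)..π, u x * Real.sin (n * x)
      = 1 / (n : ℝ) ^ 2 * Real.cos (n * π) * u₂ π - 1 / (n : ℝ) ^ 2 * Real.cos (n * 0) * u₂ 0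
        - ∫ x in (0 : ℝ)..π, 1 / (n : ℝ) ^ 2 * Real.cos (n * x) * u₃ x := by
  rcases Nat.eq_zero_or_pos n with rfl | hn
  · simp
  have hn' : (n : ℝ) ≠ 0 := by positivity
  have h1 := mul_integral_mul_sin h.deriv₃ h.continuous₃ n
  have h2 := h.integral_deriv₂_mul_sin n
  have e : ∫ x in (0 : ℝ)..π, 1 / (n : ℝ) ^ 2 * Real.cos (n * x) * u₃ x
      = 1 / (n : ℝ) ^ 2 * ∫ x in (0 : ℝ)..π, u₃ x * Real.cos (n * x) := by
    rw [← intervalIntegral.integral_const_mul]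
    congr 1; funext x; ring
  rw [h2] at h1
  rw [e]
  simp only [mul_zero, Real.cos_zero]
  field_simp
  linear_combination -h1

lemma abs_mul_sinCoeff_le (h : DerivChain u u₁ u₂ u₃) {B C : ℝ}
    (hB : ∀ x ∈ Icc 0 π, |u₂ x| ≤ B) (hC : ∀ x ∈ Icc 0 π, |u₃ x| ≤ C) (n : ℕ) :
    |n * ∫ x in (0 : ℝ)..π, u x * Real.sin (n * x)| ≤ (2 * B + C * π) * (1 / (n : ℝ) ^ 2) := by
  have hpi := Real.pi_pos
  have hcos : ∀ x : ℝ, |1 / (n : ℝ) ^ 2 * Real.cos (n * x)| ≤ 1 / (n : ℝ) ^ 2 := fun x => by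
    rw [abs_mul, abs_of_nonneg (by positivity : (0 : ℝ) ≤ 1 / (n : ℝ) ^ 2)]
    exact mul_le_of_le_one_right (by positivity) (Real.abs_cos_le_one _)
  have hterm : ∀ {x b D : ℝ}, |b| ≤ D → |1 / (n : ℝ) ^ 2 * Real.cos (n * x) * b|
      ≤ 1 / (n : ℝ) ^ 2 * D := fun {x b D} hb => by
    rw [abs_mul]
    exact mul_le_mul (hcos x) hb (abs_nonneg _) (by positivity)
  rw [h.mul_sinCoeff_eq]
  have h1 := hterm (x := π) (hB π ⟨hpi.le, le_rfl⟩)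
  have h2 := hterm (x := 0) (hB 0 ⟨le_rfl, hpi.le⟩)
  have h3 := intervalIntegral.norm_integral_le_of_norm_le_const (a := 0) (b := π)
    (f := fun x => 1 / (n : ℝ) ^ 2 * Real.cos (n * x) * u₃ x) (C := 1 / (n : ℝ) ^ 2 * C)
    fun x hx => hterm (hC x (by rw [uIoc_of_le hpi.le] at hx; exact Ioc_subset_Icc_self hx))
  rw [sub_zero, abs_of_pos hpi, Real.norm_eq_abs] at h3
  refine (abs_sub _ _).trans ?_
  have := abs_sub (1 / (n : ℝ) ^ 2 * Real.cos (n * π) * u₂ π) (1 / (n : ℝ) ^ 2 * Real.cos (n * 0) * u₂ 0)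
  linarith

/-- The derivative at the endpoint as the sum of the sine coefficients. -/
lemma hasSum_mul_sinCoeff (h : DerivChain u u₁ u₂ u₃) :
    HasSum (fun n : ℕ => n * ∫ x in (0 : ℝ)..π, u x * Real.sin (n * x)) (π / 2 * u₁ 0) := by
  have hpi := Real.pi_pos
  simp only [h.mul_sinCoeff_eq]
  set S : ℝ → ℝ := fun x => π ^ 2 / 6 - π * x / 2 + x ^ 2 / 4 with hS
  obtain ⟨C, hC⟩ := isCompact_Icc.exists_bound_of_continuousOn (s := Icc 0 π)
    h.continuous₃.continuousOn
  have hint : HasSum (fun n : ℕ => ∫ x in (0 : ℝ)..π, 1 / (n : ℝ) ^ 2 * Real.cos (n * x) * u₃ x)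
      (∫ x in (0 : ℝ)..π, S x * u₃ x) := by
    refine intervalIntegral.hasSum_integral_of_dominated_convergence
      (fun n _ => 1 / (n : ℝ) ^ 2 * C)
      (fun n => Continuous.aestronglyMeasurable (by have := h.continuous₃; fun_prop))
      (fun n => ae_of_all _ fun x hx => ?_) (ae_of_all _ fun x _ => ?_) (by simp)
      (ae_of_all _ fun x hx => ?_)
    · rw [uIoc_of_le hpi.le] at hx
      rw [norm_mul, norm_mul, Real.norm_of_nonneg (by positivity : (0 : ℝ) ≤ 1 / (n : ℝ) ^ 2)]
      refine mul_le_mul (mul_le_of_le_one_right (by positivity) (Real.abs_cos_le_one _))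
        (hC x (Ioc_subset_Icc_self hx)) (norm_nonneg _) (by positivity)
    · exact (Real.summable_one_div_nat_pow.2 one_lt_two).mul_right _
    · rw [uIoc_of_le hpi.le] at hx
      exact (hasSum_cos_div_sq (Ioc_subset_Icc_self hx)).mul_right _
  have hπ := (hasSum_cos_div_sq (x := π) ⟨hpi.le, le_rfl⟩).mul_right (u₂ π)
  have h0 := (hasSum_cos_div_sq (x := 0) ⟨le_rfl, hpi.le⟩).mul_right (u₂ 0)
  -- Integrating back by parts against the quadratic `S`: `S'(π) = 0` and `S'(0) = -π / 2` leave
  -- only `u₁ 0`, and the constant `S''` meets `u`, which vanishes at both ends.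
  have key : ∫ x in (0 : ℝ)..π, S x * u₃ x = S π * u₂ π - S 0 * u₂ 0 - π / 2 * u₁ 0 := by
    have hS' : ∀ x, HasDerivAt S (x / 2 - π / 2) x := fun x => by
      have h1 := (((hasDerivAt_id x).const_mul π).div_const 2).const_sub (π ^ 2 / 6)
      have h2 := ((hasDerivAt_id x).pow 2).div_const 4
      refine (h1.add h2).congr_deriv ?_
      simp; ring
    have hS'' : ∀ x : ℝ, HasDerivAt (fun x => x / 2 - π / 2) (1 / 2) x := fun x =>
      ((hasDerivAt_id x).div_const 2).sub_const _
    have := intervalIntegral.integral_eq_sub_of_hasDerivAt (a := 0) (b := π)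
      (f := fun x => S x * u₂ x - (x / 2 - π / 2) * u₁ x + 1 / 2 * u x) (f' := fun x => S x * u₃ x)
      (fun x _ => by
        refine ((((hS' x).mul (h.deriv₃ x)).sub ((hS'' x).mul (h.deriv₂ x))).add
          ((h.deriv₁ x).const_mul (1 / 2))).congr_deriv ?_
        ring)
      (Continuous.intervalIntegrable (by have := h.continuous₃; fun_prop) _ _)
    rw [this, h.left, h.right]
    ring
  have := (hπ.sub h0).sub hint
  rw [key] at this
  rwa [show S π * u₂ π - S 0 * u₂ 0 - (S π * u₂ π - S 0 * u₂ 0 - π / 2 * u₁ 0)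
    = π / 2 * u₁ 0 by ring] at this

end DerivChain

/-! ### Partial derivatives of test functions and the evolution of their sine coefficients. -/

lemma hasFDerivAt_of_contDiff {f : ℝ × ℝ → ℝ} (hf : ContDiff ℝ ∞ f) (q : ℝ × ℝ) :
    HasFDerivAt f (fderiv ℝ f q) q :=
  (hf.differentiable (by simp) q).hasFDerivAt

lemma hasDerivAt_partial_fst {f : ℝ × ℝ → ℝ} (hf : ContDiff ℝ ∞ f) (x t : ℝ) :
    HasDerivAt (fun ξ => f (ξ, t)) (fderiv ℝ f (x, t) (1, 0)) x :=
  (hasFDerivAt_of_contDiff hf (x, t)).comp_hasDerivAt x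
    ((hasDerivAt_id x).prodMk (hasDerivAt_const x t))

lemma hasDerivAt_partial_snd {f : ℝ × ℝ → ℝ} (hf : ContDiff ℝ ∞ f) (x t : ℝ) :
    HasDerivAt (fun s => f (x, s)) (fderiv ℝ f (x, t) (0, 1)) t :=
  (hasFDerivAt_of_contDiff hf (x, t)).comp_hasDerivAt t
    ((hasDerivAt_const t x).prodMk (hasDerivAt_id t))

lemma contDiff_fderiv_apply {f : ℝ × ℝ → ℝ} (hf : ContDiff ℝ ∞ f) (e : ℝ × ℝ) :
    ContDiff ℝ ∞ fun q => fderiv ℝ f q e :=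
  (hf.fderiv_right (m := ∞) (by simp)).clm_apply contDiff_const

namespace TestFunction

lemma dt_eq (φ : TestFunction) (x t : ℝ) :
    φ.dt x t = fderiv ℝ (fun q : ℝ × ℝ => φ.toFun q.1 q.2) (x, t) (0, 1) :=
  (hasDerivAt_partial_snd φ.smooth x t).deriv

lemma dx_eq (φ : TestFunction) (x t : ℝ) :
    φ.dx x t = fderiv ℝ (fun q : ℝ × ℝ => φ.toFun q.1 q.2) (x, t) (1, 0) :=
  (hasDerivAt_partial_fst φ.smooth x t).deriv

lemma contDiff_dt (φ : TestFunction) : ContDiff ℝ ∞ fun q : ℝ × ℝ => φ.dt q.1 q.2 := by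
  simp only [dt_eq]; exact contDiff_fderiv_apply φ.smooth _

lemma contDiff_dx (φ : TestFunction) : ContDiff ℝ ∞ fun q : ℝ × ℝ => φ.dx q.1 q.2 := by
  simp only [dx_eq]; exact contDiff_fderiv_apply φ.smooth _

lemma dxx_eq (φ : TestFunction) (x t : ℝ) :
    φ.dxx x t = fderiv ℝ (fun q : ℝ × ℝ => φ.dx q.1 q.2) (x, t) (1, 0) := by
  rw [dxx, iteratedDeriv_succ, iteratedDeriv_one]
  exact (hasDerivAt_partial_fst φ.contDiff_dx x t).deriv

lemma contDiff_dxx (φ : TestFunction) : ContDiff ℝ ∞ fun q : ℝ × ℝ => φ.dxx q.1 q.2 := by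
  simp only [dxx_eq]; exact contDiff_fderiv_apply φ.contDiff_dx _

/-- `∂ₓₓₓ φ (x, t)`. -/
def dxxx (φ : TestFunction) (x t : ℝ) : ℝ :=
  fderiv ℝ (fun q : ℝ × ℝ => φ.dxx q.1 q.2) (x, t) (1, 0)

lemma contDiff_dxxx (φ : TestFunction) : ContDiff ℝ ∞ fun q : ℝ × ℝ => φ.dxxx q.1 q.2 :=
  contDiff_fderiv_apply φ.contDiff_dxx _

lemma derivChain (φ : TestFunction) (t : ℝ) :
    DerivChain (fun x => φ.toFun x t) (fun x => φ.dx x t) (fun x => φ.dxx x t)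
      (fun x => φ.dxxx x t) where
  deriv₁ x := by rw [dx_eq]; exact hasDerivAt_partial_fst φ.smooth x t
  deriv₂ x := by rw [dxx_eq]; exact hasDerivAt_partial_fst φ.contDiff_dx x t
  deriv₃ x := hasDerivAt_partial_fst φ.contDiff_dxx x t
  continuous₃ := φ.contDiff_dxxx.continuous.comp (by fun_prop : Continuous fun x : ℝ => (x, t))
  left := φ.left t
  right := φ.right t

/-- The sine coefficients of `φ(·, t)`. -/
def sinCoeff (φ : TestFunction) (n : ℕ) (t : ℝ) : ℝ :=
  ∫ x in (0 : ℝ)..π, φ.toFun x t * Real.sin (n * x)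

end TestFunction

/-- Differentiation under the integral sign. -/
lemma hasDerivAt_intervalIntegral {F F' : ℝ → ℝ → ℝ} (hF : Continuous fun q : ℝ × ℝ => F q.1 q.2)
    (hF' : Continuous fun q : ℝ × ℝ => F' q.1 q.2)
    (h : ∀ x t, HasDerivAt (fun s => F x s) (F' x t) t) (a b t : ℝ) :
    HasDerivAt (fun t => ∫ x in a..b, F x t) (∫ x in a..b, F' x t) t := by
  obtain ⟨C, hC⟩ := (isCompact_uIcc.prod (isCompact_closedBall t 1)).exists_bound_of_continuousOn
    (s := uIcc a b ×ˢ Metric.closedBall t 1) hF'.continuousOn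
  have h1 : ∀ t, Continuous fun x => F x t := fun t =>
    hF.comp (by fun_prop : Continuous fun x : ℝ => (x, t))
  have h2 : ∀ t, Continuous fun x => F' x t := fun t =>
    hF'.comp (by fun_prop : Continuous fun x : ℝ => (x, t))
  refine (intervalIntegral.hasDerivAt_integral_of_dominated_loc_of_deriv_le
    (F := fun t x => F x t) (F' := fun t x => F' x t) (bound := fun _ => C)
    (Metric.ball_mem_nhds t one_pos)
    (Eventually.of_forall fun s => (h1 s).aestronglyMeasurable) ((h1 t).intervalIntegrable _ _)
    (h2 t).aestronglyMeasurable (ae_of_all _ fun x hx s hs => ?_) (by simp)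
    (ae_of_all _ fun x _ s _ => h x s)).2
  exact hC (x, s) ⟨uIoc_subset_uIcc hx, Metric.ball_subset_closedBall hs⟩

namespace TestFunction

lemma continuous_toFun (φ : TestFunction) : Continuous fun q : ℝ × ℝ => φ.toFun q.1 q.2 :=
  φ.smooth.continuous

lemma hasDerivAt_sinCoeff (φ : TestFunction) (n : ℕ) (t : ℝ) :
    HasDerivAt (φ.sinCoeff n) (∫ x in (0 : ℝ)..π, φ.dt x t * Real.sin (n * x)) t := by
  have h1 := φ.continuous_toFun
  have h2 := φ.contDiff_dt.continuous
  refine hasDerivAt_intervalIntegral (F := fun x t => φ.toFun x t * Real.sin (n * x))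
    (F' := fun x t => φ.dt x t * Real.sin (n * x)) (by fun_prop) (by fun_prop) (fun x t => ?_) _ _ t
  rw [dt_eq]
  exact (hasDerivAt_partial_snd φ.smooth x t).mul_const _

lemma continuous_sinCoeff (φ : TestFunction) (n : ℕ) : Continuous (φ.sinCoeff n) :=
  continuous_iff_continuousAt.2 fun t => (φ.hasDerivAt_sinCoeff n t).continuousAt

/-- The sine coefficients of `∂ₜ φ + ∂ₓₓ φ`. -/
lemma integral_dt_add_dxx_mul_sin (φ : TestFunction) (n : ℕ) (t : ℝ) :
    ∫ x in (0 : ℝ)..π, (φ.dt x t + φ.dxx x t) * Real.sin (n * x)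
      = deriv (φ.sinCoeff n) t - (n : ℝ) ^ 2 * φ.sinCoeff n t := by
  have h1 : Continuous fun x => φ.dt x t :=
    φ.contDiff_dt.continuous.comp (by fun_prop : Continuous fun x : ℝ => (x, t))
  have h2 := (φ.derivChain t).continuous₂
  simp only [add_mul]
  rw [intervalIntegral.integral_add (Continuous.intervalIntegrable (by fun_prop) _ _)
    (Continuous.intervalIntegrable (by fun_prop) _ _), (φ.hasDerivAt_sinCoeff n t).deriv,
    (φ.derivChain t).integral_deriv₂_mul_sin n, sinCoeff]
  ring

lemma continuous_deriv_sinCoeff (φ : TestFunction) (n : ℕ) : Continuous (deriv (φ.sinCoeff n)) := by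
  have : deriv (φ.sinCoeff n) = fun t => ∫ x in (0 : ℝ)..π, φ.dt x t * Real.sin (n * x) :=
    funext fun t => (φ.hasDerivAt_sinCoeff n t).deriv
  rw [this]
  have h2 := φ.contDiff_dt.continuous
  refine intervalIntegral.continuous_parametric_intervalIntegral_of_continuous'
    (f := fun t x => φ.dt x t * Real.sin (n * x)) ?_ _ _
  exact (h2.comp continuous_swap).mul (by fun_prop)

/-- A summable bound uniform in time, which dominates the boundary series in
`hasSum_integral_mul_sinCoeff`. -/
lemma exists_abs_mul_sinCoeff_le (φ : TestFunction) (T : ℝ) :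
    ∃ C : ℝ, 0 ≤ C ∧ ∀ t ∈ Icc 0 T, ∀ n : ℕ, |n * φ.sinCoeff n t| ≤ C * (1 / (n : ℝ) ^ 2) := by
  obtain ⟨B, hB⟩ := (isCompact_Icc.prod isCompact_Icc).exists_bound_of_continuousOn
    (s := Icc 0 π ×ˢ Icc 0 T) φ.contDiff_dxx.continuous.continuousOn
  obtain ⟨C, hC⟩ := (isCompact_Icc.prod isCompact_Icc).exists_bound_of_continuousOn
    (s := Icc 0 π ×ˢ Icc 0 T) φ.contDiff_dxxx.continuous.continuousOn
  refine ⟨2 * |B| + |C| * π, by positivity, fun t ht n => ?_⟩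
  exact (φ.derivChain t).abs_mul_sinCoeff_le (fun x hx => (hB (x, t) ⟨hx, ht⟩).trans (le_abs_self _))
    (fun x hx => (hC (x, t) ⟨hx, ht⟩).trans (le_abs_self _)) n

end TestFunction

/-! ### The scalar equation of one mode. -/

/-- Integration by parts for the primitive of an integrable function and a `C¹` function. -/
lemma integral_primitive_mul {k g g' : ℝ → ℝ} {τ : ℝ} (hk : IntervalIntegrable k volume 0 τ)
    (hg : ∀ t, HasDerivAt g (g' t) t) (hg' : Continuous g') :
    ∫ t in (0 : ℝ)..τ, (∫ s in (0 : ℝ)..t, k s) * g' t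
      = (∫ s in (0 : ℝ)..τ, k s) * g τ - ∫ t in (0 : ℝ)..τ, k t * g t := by
  have hd : deriv g = g' := funext fun t => (hg t).deriv
  have hgc : ContDiff ℝ 1 g := contDiff_one_iff_deriv.2
    ⟨fun t => (hg t).differentiableAt, by rw [hd]; exact hg'⟩
  have hac : AbsolutelyContinuousOnInterval g 0 τ := hgc.contDiffOn.absolutelyContinuousOnInterval
  have hac' := hk.absolutelyContinuousOnInterval_intervalIntegral (c := 0) (by simp)
  have := hac'.integral_mul_deriv_eq_deriv_mul hac
  rw [hd, intervalIntegral.integral_same, zero_mul, sub_zero] at this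
  rw [this]
  congr 1
  refine intervalIntegral.integral_congr_ae ?_
  filter_upwards [hk.ae_hasDerivAt_integral] with t ht htm
  rw [(ht (uIoc_subset_uIcc htm) 0 (by simp)).deriv]

/-- The solution of `r' = -a r + k`, `r(0) = 0`. -/
def expConv (a : ℝ) (k : ℝ → ℝ) (t : ℝ) : ℝ :=
  Real.exp (-(a * t)) * ∫ s in (0 : ℝ)..t, Real.exp (a * s) * k s

lemma intervalIntegrable_exp_mul {a : ℝ} {k : ℝ → ℝ} {b c : ℝ} (hk : IntervalIntegrable k volume b c) :
    IntervalIntegrable (fun s => Real.exp (a * s) * k s) volume b c :=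
  hk.continuousOn_mul (by fun_prop)

lemma continuous_expConv (a : ℝ) {k : ℝ → ℝ} (hk : ∀ b c, IntervalIntegrable k volume b c) :
    Continuous (expConv a k) := by
  have := intervalIntegral.continuous_primitive
    (fun b c => intervalIntegrable_exp_mul (a := a) (hk b c)) 0
  unfold expConv
  fun_prop

/-- The transposition identity for one mode. The forcing `k` is only integrable, so the parts are
integrated for the absolutely continuous primitive of `e^{a s} k` against `e^{-a t} ψ`. -/
lemma integral_expConv_mul {a τ : ℝ} {k : ℝ → ℝ} (hk : IntervalIntegrable k volume 0 τ)
    {ψ ψ' : ℝ → ℝ} (hψ : ∀ t, HasDerivAt ψ (ψ' t) t) (hψ' : Continuous ψ') :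
    ∫ t in (0 : ℝ)..τ, expConv a k t * (ψ' t - a * ψ t)
      = expConv a k τ * ψ τ - ∫ t in (0 : ℝ)..τ, k t * ψ t := by
  have hc : Continuous ψ := continuous_iff_continuousAt.2 fun t => (hψ t).continuousAt
  have h := integral_primitive_mul (intervalIntegrable_exp_mul (a := a) hk)
    (g := fun t => Real.exp (-(a * t)) * ψ t)
    (g' := fun t => Real.exp (-(a * t)) * (ψ' t - a * ψ t))
    (fun t => ((hasDerivAt_exp_neg_mul a t).mul (hψ t)).congr_deriv (by ring)) (by fun_prop)
  have e1 : ∀ t, expConv a k t * (ψ' t - a * ψ t) = (∫ s in (0 : ℝ)..t, Real.exp (a * s) * k s) *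
      (Real.exp (-(a * t)) * (ψ' t - a * ψ t)) := fun t => by rw [expConv]; ring
  have e2 : ∀ t, Real.exp (a * t) * k t * (Real.exp (-(a * t)) * ψ t) = k t * ψ t := fun t => by
    have : Real.exp (a * t) * Real.exp (-(a * t)) = 1 := by rw [← Real.exp_add]; simp
    linear_combination k t * ψ t * this
  simp only [e1, h, e2]
  rw [expConv]
  ring

lemma expConv_eq_integral (a : ℝ) (k : ℝ → ℝ) {t : ℝ} (ht : 0 ≤ t) :
    expConv a k t = ∫ s in Ioo 0 t, Real.exp (-(a * (t - s))) * k s := by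
  rw [expConv, setIntegral_Ioo_eq ht, ← intervalIntegral.integral_const_mul]
  congr 1
  funext s
  rw [← mul_assoc, ← Real.exp_add]
  ring_nf

/-- Cauchy–Schwarz with the kernel `e^{-a (t - s)}` split into two square roots; its mass is at most
`1 / a`. With `a = n²` the factor `1 / a` absorbs the `n²` coming from the boundary control. -/
lemma sq_expConv_le {a t : ℝ} (ha : 0 < a) (ht : 0 ≤ t) {k : ℝ → ℝ}
    (hk : MemLp k 2 (volume.restrict (Ioo 0 t))) :
    expConv a k t ^ 2 ≤ a⁻¹ * expConv a (fun s => k s ^ 2) t := by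
  set ρ : ℝ → ℝ := fun s => Real.exp (-(a * (t - s)) / 2)
  have hρ2 : ∀ s, ρ s * ρ s = Real.exp (-(a * (t - s))) := fun s => by
    simp only [ρ]; rw [← Real.exp_add]; ring_nf
  have hρ : Continuous ρ := by fun_prop
  have hρm := memLp_Ioo_of_continuousOn (a := 0) (b := t) hρ.continuousOn
  have hb : ∀ᵐ s ∂(volume.restrict (Ioo 0 t)), ‖ρ s‖ ≤ 1 := by
    filter_upwards [ae_restrict_mem measurableSet_Ioo] with s hs
    rw [Real.norm_of_nonneg (Real.exp_pos _).le]
    exact Real.exp_le_one_iff.2 (by nlinarith [hs.2])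
  have hkm : MemLp (fun s => ρ s * k s) 2 (volume.restrict (Ioo 0 t)) := by
    refine hk.mono (hρ.aestronglyMeasurable.mul hk.1) ?_
    filter_upwards [hb] with s hs
    rw [norm_mul]
    exact mul_le_of_le_one_left (norm_nonneg _) hs
  have h := sq_integral_mul_le hρm hkm
  have e1 : ∀ s, ρ s * (ρ s * k s) = Real.exp (-(a * (t - s))) * k s := fun s => by
    rw [← mul_assoc, hρ2]
  have e2 : ∀ s, (ρ s * k s) ^ 2 = Real.exp (-(a * (t - s))) * k s ^ 2 := fun s => by
    rw [← hρ2]; ring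
  have e3 : ∀ s, ρ s ^ 2 = Real.exp (-(a * (t - s))) := fun s => by rw [← hρ2]; ring
  simp only [e1, e2, e3] at h
  rw [← expConv_eq_integral a k ht, ← expConv_eq_integral a (fun s => k s ^ 2) ht] at h
  refine h.trans (mul_le_mul_of_nonneg_right ?_ ?_)
  · rw [setIntegral_Ioo_eq ht]
    have := intervalIntegral.integral_eq_sub_of_hasDerivAt (a := 0) (b := t)
      (f := fun s => a⁻¹ * Real.exp (-(a * (t - s)))) (f' := fun s => Real.exp (-(a * (t - s))))
      (fun s _ => by
        have := ((((hasDerivAt_id s).const_sub t).const_mul a).neg.exp).const_mul a⁻¹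
        refine this.congr_deriv ?_
        simp
        field_simp)
      (Continuous.intervalIntegrable (by fun_prop) _ _)
    rw [this]
    simp
    positivity
  · rw [expConv_eq_integral a _ ht]
    exact integral_nonneg fun s => by positivity

lemma expConv_le_integral {a t T : ℝ} (ha : 0 ≤ a) (ht : t ∈ Icc 0 T) {k : ℝ → ℝ} (hk0 : ∀ s, 0 ≤ k s)
    (hk : IntegrableOn k (Ioo 0 T)) : expConv a k t ≤ ∫ s in Ioo 0 T, k s := by
  rw [expConv_eq_integral a k ht.1]
  have hsub : Ioo 0 t ⊆ Ioo 0 T := Ioo_subset_Ioo_right ht.2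
  refine le_trans ?_ (setIntegral_mono_set hk (ae_of_all _ hk0) hsub.eventuallyLE)
  refine integral_mono_of_nonneg (ae_of_all _ fun s => mul_nonneg (Real.exp_pos _).le (hk0 s))
    (hk.mono_set hsub) ?_
  filter_upwards [ae_restrict_mem measurableSet_Ioo] with s hs
  exact mul_le_of_le_one_left (hk0 s) (Real.exp_le_one_iff.2 (by nlinarith [hs.2]))

/-- The modal identity with `ψ = 1`, after dropping the nonnegative value at `T`. -/
lemma mul_integral_expConv_le {a T : ℝ} (hT : 0 ≤ T) {k : ℝ → ℝ} (hk0 : ∀ s, 0 ≤ k s)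
    (hk : IntegrableOn k (Ioo 0 T)) :
    a * ∫ t in Ioo 0 T, expConv a k t ≤ ∫ s in Ioo 0 T, k s := by
  have hki : IntervalIntegrable k volume 0 T := by
    rw [intervalIntegrable_iff_integrableOn_Ioo_of_le hT]; exact hk
  have h := integral_expConv_mul (a := a) hki (ψ := fun _ => 1) (ψ' := fun _ => 0)
    (fun t => hasDerivAt_const t 1) continuous_const
  have h0 : 0 ≤ expConv a k T := by
    rw [expConv_eq_integral a k hT]
    exact integral_nonneg fun s => mul_nonneg (Real.exp_pos _).le (hk0 s)
  simp only [mul_one, zero_sub, mul_neg, intervalIntegral.integral_neg,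
    intervalIntegral.integral_mul_const] at h
  rw [setIntegral_Ioo_eq hT, setIntegral_Ioo_eq hT]
  linarith

/-! ### Orthogonal series in `L²` and their image in `H⁻¹`. -/

lemma norm_sq_sum_of_orthogonal {E : Type*} [NormedAddCommGroup E] [InnerProductSpace ℝ E]
    {x : ℕ → E} (h : ∀ i j, i ≠ j → inner ℝ (x i) (x j) = 0) (s : Finset ℕ) :
    ‖∑ i ∈ s, x i‖ ^ 2 = ∑ i ∈ s, ‖x i‖ ^ 2 := by
  classical
  induction s using Finset.induction_on with
  | empty => simp
  | insert a s ha ih =>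
    rw [Finset.sum_insert ha, Finset.sum_insert ha, norm_add_sq_real, ih, inner_sum,
      Finset.sum_eq_zero fun j hj => h a j (by rintro rfl; exact ha hj)]
    ring

lemma tendsto_remainder (C : ℝ) : Tendsto (fun N => C * (∑' i : ℕ, 1 / (i : ℝ) ^ 2
    - ∑ i ∈ Finset.range N, 1 / (i : ℝ) ^ 2)) atTop (𝓝 0) := by
  have hs : Summable fun i : ℕ => 1 / (i : ℝ) ^ 2 := Real.summable_one_div_nat_pow.2 one_lt_two
  have := (hs.hasSum.tendsto_sum_nat.const_sub (∑' i : ℕ, 1 / (i : ℝ) ^ 2)).const_mul C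
  rwa [sub_self, mul_zero] at this

/-- The partial sums of an orthogonal series with square summable norms converge, with a bound
for the remainder. -/
lemma exists_hasSum_of_orthogonal {E : Type*} [NormedAddCommGroup E] [InnerProductSpace ℝ E]
    [CompleteSpace E] {x : ℕ → E} (h : ∀ i j, i ≠ j → inner ℝ (x i) (x j) = 0) {C : ℝ}
    (hx : ∀ i, ‖x i‖ ^ 2 ≤ C * (1 / (i : ℝ) ^ 2)) :
    ∃ S : E, ∀ N : ℕ, ‖S - ∑ i ∈ Finset.range N, x i‖ ^ 2
      ≤ C * (∑' i : ℕ, 1 / (i : ℝ) ^ 2 - ∑ i ∈ Finset.range N, 1 / (i : ℝ) ^ 2) := by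
  have hs : Summable fun i : ℕ => 1 / (i : ℝ) ^ 2 := Real.summable_one_div_nat_pow.2 one_lt_two
  have hC : 0 ≤ C := by simpa using (sq_nonneg _).trans (hx 1)
  have hdiff : ∀ N M : ℕ, N ≤ M → ‖∑ i ∈ Finset.range M, x i - ∑ i ∈ Finset.range N, x i‖ ^ 2
      ≤ C * (∑' i : ℕ, 1 / (i : ℝ) ^ 2 - ∑ i ∈ Finset.range N, 1 / (i : ℝ) ^ 2) := by
    intro N M hNM
    rw [← Finset.sum_Ico_eq_sub _ hNM, norm_sq_sum_of_orthogonal h]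
    refine (Finset.sum_le_sum fun i _ => hx i).trans ?_
    rw [← Finset.mul_sum, Finset.sum_Ico_eq_sub _ hNM]
    have := hs.sum_le_tsum (Finset.range M) fun i _ => by positivity
    exact mul_le_mul_of_nonneg_left (by linarith) hC
  have hlim := tendsto_remainder C
  have hc : CauchySeq fun N => ∑ i ∈ Finset.range N, x i := by
    rw [Metric.cauchySeq_iff']
    intro ε hε
    obtain ⟨N, hN⟩ := (hlim.eventually (gt_mem_nhds (pow_pos hε 2))).exists
    refine ⟨N, fun M hM => ?_⟩
    rw [dist_eq_norm]
    exact lt_of_pow_lt_pow_left₀ 2 hε.le ((hdiff N M hM).trans_lt hN)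
  obtain ⟨S, hS⟩ := cauchySeq_tendsto_of_complete hc
  refine ⟨S, fun N => le_of_tendsto ((hS.sub_const _).norm.pow 2) ?_⟩
  exact eventually_atTop.2 ⟨N, fun M hM => hdiff N M hM⟩

/-- `sin(n x)` in `L²(0, π)`. -/
def sinL2 (n : ℕ) : L2 := toL2 (fun x => Real.sin (n * x)) (by fun_prop)

/-- `cos(n x)` in `L²(0, π)`. -/
def cosL2 (n : ℕ) : L2 := toL2 (fun x => Real.cos (n * x)) (by fun_prop)

lemma norm_toHneg1_le (f : L2) : ‖L2.toHneg1 f‖ ≤ ‖f‖ := by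
  refine ContinuousLinearMap.opNorm_le_bound _ (norm_nonneg _) fun u => ?_
  refine (abs_real_inner_le_norm f u.1.fst).trans ?_
  exact mul_le_mul_of_nonneg_left (WithLp.norm_fst_le (p := 2) L2 u.1) (norm_nonneg _)

/-- The embedding `L²(0, π) → H⁻¹(0, π)` as a continuous linear map. -/
def toHneg1L : L2 →L[ℝ] Hneg1 :=
  LinearMap.mkContinuous (E := L2) (F := Hneg1) (σ := RingHom.id ℝ)
    { toFun := L2.toHneg1
      map_add' := fun f g => ContinuousLinearMap.ext fun u => inner_add_left f g u.1.fst
      map_smul' := fun c f => ContinuousLinearMap.ext fun u => real_inner_smul_left f u.1.fst c }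
    1 fun f => (norm_toHneg1_le f).trans_eq (one_mul _).symm

/-- The functional `u ↦ ∫ g u'`, minus the distributional derivative of `g`. -/
def derivHneg1 (g : L2) : Hneg1 :=
  (innerSL ℝ g).comp ((WithLp.sndL 2 ℝ L2 L2).comp H10.subtypeL)

lemma derivHneg1_apply (g : L2) (u : H10) : derivHneg1 g u = inner ℝ g u.1.snd := rfl

lemma norm_derivHneg1_le (f : L2) : ‖derivHneg1 f‖ ≤ ‖f‖ := by
  refine ContinuousLinearMap.opNorm_le_bound _ (norm_nonneg _) fun u => ?_
  refine (abs_real_inner_le_norm f u.1.snd).trans ?_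
  exact mul_le_mul_of_nonneg_left (WithLp.norm_snd_le (p := 2) L2 u.1) (norm_nonneg _)

/-- `derivHneg1` as a continuous linear map. -/
def derivHneg1L : L2 →L[ℝ] Hneg1 :=
  LinearMap.mkContinuous (E := L2) (F := Hneg1) (σ := RingHom.id ℝ)
    { toFun := derivHneg1
      map_add' := fun f g => ContinuousLinearMap.ext fun u => inner_add_left f g u.1.snd
      map_smul' := fun c f => ContinuousLinearMap.ext fun u => real_inner_smul_left f u.1.snd c }
    1 fun f => (norm_derivHneg1_le f).trans_eq (one_mul _).symm

lemma toHneg1L_apply (f : L2) : toHneg1L f = L2.toHneg1 f := rfl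

lemma derivHneg1L_apply (f : L2) : derivHneg1L f = derivHneg1 f := rfl

lemma inner_toL2_left {f : ℝ → ℝ} (hf : Continuous f) (g : L2) :
    inner ℝ (toL2 f hf) g = ∫ x in Ioo 0 π, g x * f x := by
  rw [L2.inner_def]
  refine integral_congr_ae ((memLp_of_continuous hf).coeFn_toLp.mono fun x hx => ?_)
  simp [toL2, hx]

/-- The factor `1 / n` gained in `H⁻¹` makes sine series with merely bounded coefficients converge
there. -/
lemma toHneg1_sinL2 (n : ℕ) : L2.toHneg1 (sinL2 n) = (1 / (n : ℝ)) • derivHneg1 (cosL2 n) := by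
  ext u
  rw [smul_apply, toHneg1_apply, derivHneg1_apply, sinL2, cosL2,
    inner_toL2_left, inner_toL2_left, smul_eq_mul]
  rcases Nat.eq_zero_or_pos n with rfl | hn
  · simp
  -- Membership in `H10` is tested with compactly supported functions only; this cutoff is 1 on `(0,
  -- π)` because `π < 4`.
  let b : ContDiffBump (0 : ℝ) := ⟨4, 5, by norm_num, by norm_num⟩
  set χ : ℝ → ℝ := fun x => b x * Real.cos (n * x)
  have hχ : ContDiff ℝ ∞ χ := b.contDiff.mul (by fun_prop)
  have hcomp : HasCompactSupport χ := b.hasCompactSupport.mul_right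
  have hb : ∀ x ∈ Ioo 0 π, x ∈ Metric.ball (0 : ℝ) 4 := fun x hx => by
    rw [mem_ball_zero_iff, Real.norm_eq_abs, abs_of_pos hx.1]
    linarith [hx.2, Real.pi_lt_four]
  have h := u.2 χ hχ hcomp
  have e1 : ∫ x in Ioo 0 π, u.1.fst x * deriv χ x
      = -(n * ∫ x in Ioo 0 π, u.1.fst x * Real.sin (n * x)) := by
    rw [← integral_const_mul, ← integral_neg]
    refine setIntegral_congr_fun measurableSet_Ioo fun x hx => ?_
    have : χ =ᶠ[𝓝 x] fun x => Real.cos (n * x) := by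
      filter_upwards [Metric.isOpen_ball.mem_nhds (hb x hx)] with y hy
      simp only [χ]
      rw [b.one_of_mem_closedBall (Metric.ball_subset_closedBall hy), one_mul]
    rw [this.deriv_eq, deriv_cos_mul]
    ring
  have e2 : ∫ x in Ioo 0 π, u.1.snd x * χ x = ∫ x in Ioo 0 π, u.1.snd x * Real.cos (n * x) := by
    refine setIntegral_congr_fun measurableSet_Ioo fun x hx => ?_
    simp only [χ]
    rw [b.one_of_mem_closedBall (Metric.ball_subset_closedBall (hb x hx)), one_mul]
  rw [e1, e2, neg_inj] at h
  rw [← h]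
  have : (n : ℝ) ≠ 0 := by positivity
  field_simp

lemma inner_cosL2 {m n : ℕ} (h : m ≠ n) : inner ℝ (cosL2 m) (cosL2 n) = 0 := by
  rw [cosL2, cosL2, inner_toL2]
  exact_mod_cast integral_cos_mul_cos (m := m) (n := n) (by omega) (by omega)

lemma integral_sin_mul_sin_nat {m n : ℕ} (h : m ≠ n) :
    ∫ x in (0 : ℝ)..π, Real.sin (m * x) * Real.sin (n * x) = 0 := by
  exact_mod_cast integral_sin_mul_sin (m := m) (n := n) (by omega) (by omega)

lemma norm_sq_cosL2_le (n : ℕ) : ‖cosL2 n‖ ^ 2 ≤ π := by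
  rw [← real_inner_self_eq_norm_sq, cosL2, inner_toL2]
  have : ∫ x in (0 : ℝ)..π, Real.cos (n * x) * Real.cos (n * x) ≤ ∫ x in (0 : ℝ)..π, (1 : ℝ) := by
    refine intervalIntegral.integral_mono_on Real.pi_pos.le
      (Continuous.intervalIntegrable (by fun_prop) _ _) (by simp) fun x _ => ?_
    rw [← sq]
    exact Real.cos_sq_le_one _
  simpa using this

lemma sum_toLp {X : Type*} [MeasurableSpace X] {μ : Measure X} {f : ℕ → X → ℝ}
    (hf : ∀ n, MemLp (f n) 2 μ) (s : Finset ℕ) :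
    ∑ n ∈ s, (hf n).toLp (f n)
      = (memLp_finsetSum s fun n _ => hf n).toLp (fun x => ∑ n ∈ s, f n x) := by
  classical
  induction s using Finset.induction_on with
  | empty => simp; rfl
  | insert a s ha ih =>
    rw [Finset.sum_insert ha, ih, ← MemLp.toLp_add]
    refine MemLp.toLp_congr _ _ (ae_of_all _ fun x => ?_)
    simp [Finset.sum_insert ha]

lemma volume_restrict_prod (T : ℝ) : (volume.restrict (Ioo 0 π ×ˢ Ioo 0 T) : Measure (ℝ × ℝ))
    = μΩ.prod (volume.restrict (Ioo 0 T)) := by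
  rw [Measure.prod_restrict, ← Measure.volume_eq_prod]

lemma setIntegral_prod_symm {T : ℝ} {g : ℝ × ℝ → ℝ}
    (hg : Integrable g (volume.restrict (Ioo 0 π ×ˢ Ioo 0 T))) :
    ∫ q in Ioo 0 π ×ˢ Ioo 0 T, g q = ∫ t in Ioo 0 T, ∫ x in Ioo 0 π, g (x, t) := by
  rw [volume_restrict_prod] at hg ⊢
  exact integral_prod_symm _ hg

/-- A sine series with coefficients `yₙ` such that `|yₙ| ≤ K` and `∫ yₙ² ≤ K / n²` represents an
element of `L²((0, π) × (0, T)) ∩ C⁰([0, T]; H⁻¹(0, π))`. -/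
theorem exists_curve_of_sinCoeff {T K : ℝ} {y : ℕ → ℝ → ℝ} (hy : ∀ n, Continuous (y n))
    (hb : ∀ n, ∀ t ∈ Icc 0 T, |y n t| ≤ K)
    (hi : ∀ n : ℕ, ∫ t in Ioo 0 T, y n t ^ 2 ≤ K * (1 / (n : ℝ) ^ 2)) :
    ∃ (f : ℝ × ℝ → ℝ) (Y : ℝ → Hneg1), IsL2CurveRep T f Y ∧
      (∀ g : ℝ × ℝ → ℝ, MemLp g 2 (volume.restrict (Ioo 0 π ×ˢ Ioo 0 T)) →
        Tendsto (fun N => ∫ q in Ioo 0 π ×ˢ Ioo 0 T,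
          (∑ n ∈ Finset.range N, y n q.2 * Real.sin (n * q.1)) * g q) atTop
          (𝓝 (∫ q in Ioo 0 π ×ˢ Ioo 0 T, f q * g q))) ∧
      ∀ τ ∈ Icc 0 T, Tendsto (fun N => ∑ n ∈ Finset.range N, y n τ • L2.toHneg1 (sinL2 n)) atTop
        (𝓝 (Y τ)) := by
  -- the `H⁻¹` valued curve
  have hG : ∀ t ∈ Icc 0 T, ∃ S : L2, ∀ N : ℕ,
      ‖S - ∑ n ∈ Finset.range N, (y n t * (1 / (n : ℝ))) • cosL2 n‖ ^ 2
      ≤ K ^ 2 * π * (∑' i : ℕ, 1 / (i : ℝ) ^ 2 - ∑ i ∈ Finset.range N, 1 / (i : ℝ) ^ 2) := by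
    intro t ht
    refine exists_hasSum_of_orthogonal (fun i j hij => ?_) fun n => ?_
    · rw [real_inner_smul_left, real_inner_smul_right, inner_cosL2 hij, mul_zero, mul_zero]
    · rw [norm_smul, mul_pow, Real.norm_eq_abs, sq_abs, mul_pow]
      have h1 : y n t ^ 2 ≤ K ^ 2 := sq_le_sq' (neg_le_of_abs_le (hb n t ht))
        (le_of_abs_le (hb n t ht))
      calc y n t ^ 2 * (1 / (n : ℝ)) ^ 2 * ‖cosL2 n‖ ^ 2
          ≤ K ^ 2 * (1 / (n : ℝ)) ^ 2 * π := by
            gcongr; exact norm_sq_cosL2_le n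
        _ = _ := by rw [div_pow]; ring
  choose! G hG using hG
  -- The remainder bound does not depend on `t`, so continuity passes to the limit.
  have hunif : TendstoUniformlyOn (fun (N : ℕ) t => ∑ n ∈ Finset.range N,
      (y n t * (1 / (n : ℝ))) • cosL2 n) G atTop (Icc 0 T) := by
    rw [Metric.tendstoUniformlyOn_iff]
    intro ε hε
    filter_upwards [(tendsto_remainder (K ^ 2 * π)).eventually (gt_mem_nhds (pow_pos hε 2))]
      with N hN t ht
    rw [dist_eq_norm]
    exact lt_of_pow_lt_pow_left₀ 2 hε.le ((hG t ht N).trans_lt hN)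
  have hGc : ContinuousOn G (Icc 0 T) :=
    hunif.continuousOn (Eventually.frequently (Eventually.of_forall fun N =>
      (continuous_finsetSum _ fun n _ =>
        ((hy n).mul continuous_const).smul continuous_const).continuousOn))
  have hYlim : ∀ τ ∈ Icc 0 T, Tendsto
      (fun N => ∑ n ∈ Finset.range N, y n τ • L2.toHneg1 (sinL2 n)) atTop
        (𝓝 (derivHneg1L (G τ))) := by
    intro τ hτ
    have := (derivHneg1L.continuous.tendsto _).comp (hunif.tendsto_at hτ)
    refine this.congr fun N => ?_
    rw [Function.comp_apply, map_sum]
    refine Finset.sum_congr rfl fun n _ => ?_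
    rw [map_smul, toHneg1_sinL2, smul_smul, derivHneg1L_apply]
  -- the function on the space-time domain
  set μQ : Measure (ℝ × ℝ) := volume.restrict (Ioo 0 π ×ˢ Ioo 0 T)
  have hprod : μQ = μΩ.prod (volume.restrict (Ioo 0 T)) := volume_restrict_prod T
  have hXm : ∀ n, MemLp (fun q : ℝ × ℝ => y n q.2 * Real.sin (n * q.1)) 2 μQ := fun n =>
    memLp_prod_of_continuous (by have := hy n; fun_prop)
  have hXint : ∀ m n, inner ℝ ((hXm m).toLp _) ((hXm n).toLp _)
      = (∫ x in (0 : ℝ)..π, Real.sin (m * x) * Real.sin (n * x)) *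
        ∫ t in Ioo 0 T, y m t * y n t := by
    intro m n
    rw [← integral_mul_eq_inner (hXm m) (hXm n), hprod, ← setIntegral_Ioo_eq Real.pi_pos.le,
      ← integral_prod_mul]
    congr 1; funext q; ring
  obtain ⟨F, hF⟩ := exists_hasSum_of_orthogonal (x := fun n => (hXm n).toLp _) (C := π * K)
    (fun i j hij => by rw [hXint, integral_sin_mul_sin_nat hij, zero_mul]) fun n => by
      rw [← real_inner_self_eq_norm_sq, hXint, mul_assoc]
      have h1 : ∫ x in (0 : ℝ)..π, Real.sin (n * x) * Real.sin (n * x) ≤ π := by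
        have : ∫ x in (0 : ℝ)..π, Real.sin (n * x) * Real.sin (n * x)
            ≤ ∫ x in (0 : ℝ)..π, (1 : ℝ) := by
          refine intervalIntegral.integral_mono_on Real.pi_pos.le
            (Continuous.intervalIntegrable (by fun_prop) _ _) (by simp) fun x _ => ?_
          rw [← sq]
          exact Real.sin_sq_le_one _
        simpa using this
      have h2 := hi n
      simp only [sq] at h2
      refine mul_le_mul h1 (by simpa only [sq] using h2)
        (integral_nonneg fun _ => mul_self_nonneg _) Real.pi_pos.le
  have hFlim : Tendsto (fun N => ∑ n ∈ Finset.range N, (hXm n).toLp _) atTop (𝓝 F) := by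
    rw [tendsto_iff_norm_sub_tendsto_zero]
    have h0 : Tendsto (fun N => ‖F - ∑ n ∈ Finset.range N, (hXm n).toLp _‖ ^ 2) atTop (𝓝 0) :=
      squeeze_zero (fun _ => sq_nonneg _) hF (tendsto_remainder _)
    have := h0.sqrt
    simpa [Real.sqrt_sq, norm_sub_rev] using this
  have hFm : MemLp F 2 μQ := Lp.memLp F
  refine ⟨F, fun t => derivHneg1L (G t), ⟨hFm, derivHneg1L.continuous.comp_continuousOn hGc, ?_⟩,
    fun g hg => ?_, hYlim⟩
  · -- slices
    have hSm : ∀ N, MemLp (fun q : ℝ × ℝ => ∑ n ∈ Finset.range N, y n q.2 * Real.sin (n * q.1))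
        2 μQ := fun N => memLp_finsetSum _ fun n _ => hXm n
    -- Squared distance in `L²(0, π)` between the slices at time `t`. It tends to 0 in `L¹(0, T)`,
    -- hence almost everywhere along a subsequence, and there the `H⁻¹` limit must agree with the
    -- slice of `F`.
    set d : ℕ → ℝ → ℝ := fun N t => ∫ x in Ioo 0 π,
      ((∑ n ∈ Finset.range N, y n t * Real.sin (n * x)) - F (x, t)) ^ 2
    have hsq : ∀ N, Integrable (fun q : ℝ × ℝ =>
        ((∑ n ∈ Finset.range N, y n q.2 * Real.sin (n * q.1)) - F q) ^ 2)
        (μΩ.prod (volume.restrict (Ioo 0 T))) := fun N => by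
      rw [← hprod]
      exact ((hSm N).sub hFm).integrable_sq
    have hdint : ∀ N, ∫ t in Ioo 0 T, d N t
        = ‖F - ∑ n ∈ Finset.range N, (hXm n).toLp _‖ ^ 2 := fun N => by
      have e : (∑ n ∈ Finset.range N, (hXm n).toLp _) - F = ((hSm N).sub hFm).toLp _ := by
        rw [sum_toLp, MemLp.toLp_sub (hSm N) hFm, Lp.toLp_coeFn]
      rw [norm_sub_rev, e, ← integral_sq_eq_norm_sq]
      exact (setIntegral_prod_symm ((hSm N).sub hFm).integrable_sq).symm
    have hdi : ∀ N, Integrable (d N) (volume.restrict (Ioo 0 T)) := fun N =>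
      (hsq N).integral_prod_right
    have hd0 : ∀ N t, 0 ≤ d N t := fun N t => integral_nonneg fun _ => sq_nonneg _
    have hdlim : Tendsto (fun N => eLpNorm (d N - 0) 1 (volume.restrict (Ioo 0 T))) atTop
        (𝓝 0) := by
      have h0 : Tendsto (fun N => ‖F - ∑ n ∈ Finset.range N, (hXm n).toLp _‖ ^ 2) atTop (𝓝 0) :=
        squeeze_zero (fun _ => sq_nonneg _) hF (tendsto_remainder _)
      have h1 := ENNReal.tendsto_ofReal h0
      rw [ENNReal.ofReal_zero] at h1
      refine h1.congr fun N => ?_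
      rw [sub_zero, eLpNorm_one_eq_lintegral_enorm, ← ofReal_integral_norm_eq_lintegral_enorm (hdi N),
        ← hdint]
      congr 2
      funext t
      rw [Real.norm_of_nonneg (hd0 N t)]
    obtain ⟨ns, hns, hae⟩ := (tendstoInMeasure_of_tendsto_eLpNorm one_ne_zero
      (fun N => (hdi N).1) aestronglyMeasurable_zero hdlim).exists_seq_tendsto_ae
    have hFsq : Integrable (fun q : ℝ × ℝ => F q ^ 2) (μΩ.prod (volume.restrict (Ioo 0 T))) := by
      rw [← hprod]; exact hFm.integrable_sq
    filter_upwards [hae, hFsq.prod_left_ae, ae_restrict_mem measurableSet_Ioo] with t ht hsl htm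
    have hslm : MemLp (fun x => F (x, t)) 2 μΩ := by
      refine (memLp_two_iff_integrable_sq ?_).2 hsl
      exact ((Lp.stronglyMeasurable F).comp_measurable measurable_prodMk_right).aestronglyMeasurable
    refine ⟨hslm, ?_⟩
    have hm : ∀ n, MemLp (fun x => y n t * Real.sin (n * x)) 2 μΩ := fun n =>
      memLp_of_continuous (by fun_prop)
    have hterm : ∀ n, (hm n).toLp _ = y n t • sinL2 n := fun n =>
      toL2_const_mul _ (by fun_prop) fun x => rfl
    have hnorm : ∀ N, ‖(∑ n ∈ Finset.range N, y n t • sinL2 n) - hslm.toLp _‖ ^ 2 = d N t := by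
      intro N
      simp only [← hterm]
      rw [sum_toLp, ← MemLp.toLp_sub, ← integral_sq_eq_norm_sq]
      rfl
    have hconv : Tendsto (fun i => ∑ n ∈ Finset.range (ns i), y n t • sinL2 n) atTop
        (𝓝 (hslm.toLp _)) := by
      rw [tendsto_iff_norm_sub_tendsto_zero]
      have := ht.sqrt
      simpa [← hnorm, Real.sqrt_sq] using this
    have h1 := (toHneg1L.continuous.tendsto _).comp hconv
    have h2 := (hYlim t (Ioo_subset_Icc_self htm)).comp hns.tendsto_atTop
    refine tendsto_nhds_unique h2 (h1.congr fun i => ?_)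
    simp only [Function.comp_apply, map_sum, map_smul, toHneg1L_apply]
  · have h1 : Tendsto (fun N => inner ℝ (∑ n ∈ Finset.range N, (hXm n).toLp _) (hg.toLp g)) atTop
        (𝓝 (inner ℝ F (hg.toLp g))) := hFlim.inner tendsto_const_nhds
    have h2 : inner ℝ F (hg.toLp g) = ∫ q, F q * g q ∂μQ := by
      rw [integral_mul_eq_inner hFm hg, Lp.toLp_coeFn]
    rw [← h2]
    refine h1.congr fun N => ?_
    rw [sum_toLp, ← integral_mul_eq_inner]

/-! ### The sine series of the source term and pairings with test functions. -/

lemma integrable_mul_of_memLp {X : Type*} [MeasurableSpace X] {μ : Measure X} {f g : X → ℝ}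
    (hf : MemLp f 2 μ) (hg : MemLp g 2 μ) : Integrable (fun x => f x * g x) μ :=
  hf.integrable_mul hg

lemma continuous_coupling : Continuous coupling :=
  continuous_tsum (fun _ => by fun_prop) summable_one_div_succ_sq fun j x =>
    abs_coupling_term_le j x

lemma hasSum_extend_mul {e : ℕ → ℕ} (he : Function.Injective e) {c g : ℕ → ℝ} {a : ℝ}
    (h : HasSum (fun j => c j * g (e j)) a) :
    HasSum (fun n => Function.extend e c 0 n * g n) a := by
  refine (he.hasSum_iff fun n hn => ?_).1 (h.congr_fun fun j => ?_)
  · rw [Function.extend_apply' _ _ _ hn, Pi.zero_apply, zero_mul]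
  · rw [Function.comp_apply, he.extend_apply]

/-- The sine series of `α w₁`. -/
lemma exists_sinCoeff_coupling_mul : ∃ b : ℕ → ℝ, b 0 = 0 ∧ Summable (fun n => |b n|) ∧
    ∀ x, HasSum (fun n : ℕ => b n * Real.sin (n * x)) (coupling x * eigenfunction 1 x) := by
  set c : ℕ → ℝ := fun j => √(2 / π) / 2 * (1 / ((j : ℝ) + 1) ^ 2)
  have hc : Summable c := summable_one_div_succ_sq.mul_left _
  have hc0 : ∀ j, 0 ≤ c j := fun j => by positivity
  -- The product of `cos(15 (j+1) x)` and `sin x` has the frequencies `15 (j+1) ± 1`, that is `15 j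
  -- + 16` with sign `+` and `15 j + 14` with sign `-`.
  have h1 : Function.Injective fun j : ℕ => 15 * j + 16 := fun i j h => by
    simp only at h; omega
  have h2 : Function.Injective fun j : ℕ => 15 * j + 14 := fun i j h => by
    simp only at h; omega
  have hs : ∀ {e : ℕ → ℕ}, Function.Injective e → Summable fun n => |Function.extend e c 0 n| := by
    intro e he
    have := (hasSum_extend_mul he (c := c) (g := fun _ => 1)
      (by simpa using hc.hasSum)).summable
    simpa using this.abs
  refine ⟨fun n => Function.extend (fun j : ℕ => 15 * j + 16) c 0 n
    - Function.extend (fun j : ℕ => 15 * j + 14) c 0 n, ?_, ?_, fun x => ?_⟩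
  · beta_reduce
    rw [Function.extend_apply' _ _ _ (by rintro ⟨j, hj⟩; omega),
      Function.extend_apply' _ _ _ (by rintro ⟨j, hj⟩; omega)]
    simp
  · exact Summable.of_nonneg_of_le (fun _ => abs_nonneg _) (fun n => abs_sub _ _)
      ((hs h1).add (hs h2))
  · have hsum : ∀ {e : ℕ → ℕ}, Function.Injective e → HasSum
        (fun n : ℕ => Function.extend e c 0 n * Real.sin (n * x))
        (∑' j, c j * Real.sin (e j * x)) := fun {e} he => by
      refine hasSum_extend_mul he (g := fun n => Real.sin (n * x)) (Summable.hasSum ?_)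
      refine Summable.of_norm_bounded hc fun j => ?_
      rw [norm_mul, Real.norm_of_nonneg (hc0 j)]
      exact mul_le_of_le_one_right (hc0 j) (Real.abs_sin_le_one _)
    have hsc : ∀ e : ℕ → ℕ, Summable fun j => c j * Real.sin (e j * x) := fun e =>
      Summable.of_norm_bounded hc fun j => by
        rw [norm_mul, Real.norm_of_nonneg (hc0 j)]
        exact mul_le_of_le_one_right (hc0 j) (Real.abs_sin_le_one _)
    have h3 := (hsum h1).sub (hsum h2)
    simp only [← sub_mul] at h3
    have h4 := ((hsc fun j => 15 * j + 16).hasSum).sub ((hsc fun j => 15 * j + 14).hasSum)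
    have h5 : HasSum (fun j => c j * Real.sin ((15 * j + 16 : ℕ) * x)
        - c j * Real.sin ((15 * j + 14 : ℕ) * x)) (coupling x * eigenfunction 1 x) := by
      refine ((hasSum_coupling x).mul_right (eigenfunction 1 x)).congr_fun fun j => ?_
      push_cast
      rw [show (15 * (j : ℝ) + 16) * x = 15 * ((j : ℝ) + 1) * x + x by ring,
        show (15 * (j : ℝ) + 14) * x = 15 * ((j : ℝ) + 1) * x - x by ring,
        Real.sin_add, Real.sin_sub]
      simp only [eigenfunction, c, Nat.cast_one, one_mul]
      ring
    rwa [h4.unique h5] at h3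

lemma toHneg1_toL2_slice {f : ℝ → ℝ} (hf : Continuous f) (φ : TestFunction) (t : ℝ) :
    L2.toHneg1 (toL2 f hf) (φ.slice t) = ∫ x in (0 : ℝ)..π, f x * φ.toFun x t := by
  rw [toHneg1_apply]
  exact inner_toL2 _ (φ.continuous_left t)

lemma toHneg1_sinL2_slice (n : ℕ) (φ : TestFunction) (t : ℝ) :
    L2.toHneg1 (sinL2 n) (φ.slice t) = φ.sinCoeff n t := by
  rw [sinL2, toHneg1_toL2_slice, TestFunction.sinCoeff]
  simp only [mul_comm]

lemma w_one_slice (φ : TestFunction) (t : ℝ) : w 1 (φ.slice t) = √(2 / π) * φ.sinCoeff 1 t := by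
  rw [w, toHneg1_toL2_slice, TestFunction.sinCoeff, ← intervalIntegral.integral_const_mul]
  simp only [eigenfunction]
  congr 1; funext x; ring

/-- Transfers the weak convergence on `(0, T)` to `(0, τ)` by putting the time cutoff into the test
function. -/
lemma setIntegral_mul_indicator {T τ : ℝ} (hτ : τ ≤ T) (f g : ℝ × ℝ → ℝ) :
    ∫ q in Ioo 0 π ×ˢ Ioo 0 T, f q * (Ioo 0 π ×ˢ Ioo 0 τ).indicator g q
      = ∫ q in Ioo 0 π ×ˢ Ioo 0 τ, f q * g q := by
  have hsub : Ioo 0 π ×ˢ Ioo 0 τ ⊆ Ioo 0 π ×ˢ Ioo 0 T :=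
    Set.prod_mono le_rfl (Ioo_subset_Ioo_right hτ)
  have : (fun q => f q * (Ioo 0 π ×ˢ Ioo 0 τ).indicator g q)
      = (Ioo 0 π ×ˢ Ioo 0 τ).indicator fun q => f q * g q :=
    funext fun q => (Set.indicator_mul_right _ f g).symm
  rw [this, setIntegral_indicator (measurableSet_Ioo.prod measurableSet_Ioo),
    inter_eq_self_of_subset_right hsub]

lemma setIntegral_prod_sin_mul {τ : ℝ} (hτ : 0 ≤ τ) (n : ℕ) {r : ℝ → ℝ} (hr : Continuous r)
    {G : ℝ × ℝ → ℝ} (hG : Continuous G) :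
    ∫ q in Ioo 0 π ×ˢ Ioo 0 τ, (r q.2 * Real.sin (n * q.1)) * G q
      = ∫ t in (0 : ℝ)..τ, r t * ∫ x in (0 : ℝ)..π, G (x, t) * Real.sin (n * x) := by
  rw [setIntegral_prod_symm (integrable_mul_of_memLp (memLp_prod_of_continuous (by fun_prop))
    (memLp_prod_of_continuous hG)), setIntegral_Ioo_eq hτ]
  congr 1
  funext t
  rw [setIntegral_Ioo_eq Real.pi_pos.le, ← intervalIntegral.integral_const_mul]
  congr 1
  funext x
  ring

namespace TestFunction

lemma continuous_dt_add_dxx (φ : TestFunction) :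
    Continuous fun q : ℝ × ℝ => φ.dt q.1 q.2 + φ.dxx q.1 q.2 :=
  φ.contDiff_dt.continuous.add φ.contDiff_dxx.continuous

end TestFunction

/-! ### Construction of the solution. -/

/-- `z(x, t) = e^{-t} w₁(x)` as a curve in `H⁻¹(0, π)`. -/
lemma isL2CurveRep_exp_eigenfunction (T : ℝ) :
    IsL2CurveRep T (fun q => Real.exp (-q.2) * eigenfunction 1 q.1)
      (fun t => Real.exp (-t) • w 1) where
  memLp := memLp_prod_of_continuous
    (by have := continuous_eigenfunction 1; fun_prop)
  continuousOn := by fun_prop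
  eq_ae := ae_of_all _ fun t => by
    have hc := continuous_eigenfunction 1
    refine ⟨memLp_of_continuous (by fun_prop), ?_⟩
    have := toL2_const_mul hc (by fun_prop : Continuous fun x => Real.exp (-t) * eigenfunction 1 x)
      fun x => rfl
    rw [toL2] at this
    rw [this, ← toHneg1L_apply, map_smul]
    rfl

/-- Only the first sine coefficient of `ψ` enters, and the time integrand is the derivative of
`√(2/π) e^{-t} ψ₁(t)`. -/
lemma exp_eigenfunction_eq {τ : ℝ} (hτ : 0 ≤ τ) (ψ : TestFunction) :
    (Real.exp (-τ) • w 1) (ψ.slice τ) - w 1 (ψ.slice 0)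
      = ∫ q in Ioo 0 π ×ˢ Ioo 0 τ, (Real.exp (-q.2) * eigenfunction 1 q.1)
        * (ψ.dt q.1 q.2 + ψ.dxx q.1 q.2) := by
  have h := setIntegral_prod_sin_mul hτ 1 (r := fun t => √(2 / π) * Real.exp (-t)) (by fun_prop)
    ψ.continuous_dt_add_dxx
  simp only [ψ.integral_dt_add_dxx_mul_sin] at h
  have hc := ψ.continuous_sinCoeff 1
  have hc' := ψ.continuous_deriv_sinCoeff 1
  have e : ∀ q : ℝ × ℝ, Real.exp (-q.2) * eigenfunction 1 q.1
      = √(2 / π) * Real.exp (-q.2) * Real.sin ((1 : ℕ) * q.1) := fun q => by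
    rw [eigenfunction]; ring
  simp only [e, h]
  rw [smul_apply, smul_eq_mul, w_one_slice, w_one_slice]
  rw [intervalIntegral.integral_eq_sub_of_hasDerivAt
    (f := fun t => √(2 / π) * Real.exp (-t) * ψ.sinCoeff 1 t) (fun t _ => ?_)
    (Continuous.intervalIntegrable (by fun_prop) _ _)]
  · simp; ring
  · have h1 := (hasDerivAt_exp_neg_mul 1 t).const_mul (√(2 / π))
    simp only [one_mul] at h1
    refine (h1.mul (ψ.hasDerivAt_sinCoeff 1 t)).congr_deriv ?_
    rw [(ψ.hasDerivAt_sinCoeff 1 t).deriv]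
    push_cast
    ring

/-- The sum of the contributions of the boundary control. -/
lemma hasSum_integral_mul_sinCoeff {τ : ℝ} {v : ℝ → ℝ}
    (hv : Integrable v (volume.restrict (Ioo 0 τ))) (φ : TestFunction) :
    HasSum (fun n : ℕ => ∫ t in Ioo 0 τ, 2 / π * (v t * (n * φ.sinCoeff n t)))
      (∫ t in Ioo 0 τ, v t * φ.dx 0 t) := by
  obtain ⟨C, hC0, hC⟩ := φ.exists_abs_mul_sinCoeff_le τ
  have hs : Summable fun i : ℕ => 1 / (i : ℝ) ^ 2 := Real.summable_one_div_nat_pow.2 one_lt_two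
  have hbound : ∀ n : ℕ, ∀ᵐ t ∂(volume.restrict (Ioo 0 τ)),
      ‖2 / π * (v t * (n * φ.sinCoeff n t))‖ ≤ 2 / π * (‖v t‖ * (C * (1 / (n : ℝ) ^ 2))) := by
    intro n
    filter_upwards [ae_restrict_mem measurableSet_Ioo] with t ht
    rw [norm_mul, norm_mul, Real.norm_of_nonneg (by positivity : (0 : ℝ) ≤ 2 / π)]
    have := hC t (Ioo_subset_Icc_self ht) n
    gcongr
    exact this
  have hlim : ∀ t, HasSum (fun n : ℕ => 2 / π * (v t * (n * φ.sinCoeff n t)))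
      (v t * φ.dx 0 t) := fun t => by
    have h1 := (((φ.derivChain t).hasSum_mul_sinCoeff).mul_left (v t)).mul_left (2 / π)
    have e : 2 / π * (v t * (π / 2 * φ.dx 0 t)) = v t * φ.dx 0 t := by
      have := Real.pi_ne_zero
      field_simp
    rwa [e] at h1
  refine hasSum_integral_of_dominated_convergence
    (fun n t => 2 / π * (‖v t‖ * (C * (1 / (n : ℝ) ^ 2))))
    (fun n => ?_) hbound (ae_of_all _ fun t => ?_) ?_ (ae_of_all _ hlim)
  · exact (hv.1.mul ((φ.continuous_sinCoeff n).const_mul _).aestronglyMeasurable).const_mul _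
  · exact ((hs.mul_left C).mul_left _).mul_left _
  · simp only [tsum_mul_left]
    exact (hv.norm.mul_const _).const_mul _

/-- The sum of the contributions of the coupling term. -/
lemma hasSum_integral_sinCoeff {τ : ℝ} (hτ : 0 ≤ τ) {b : ℕ → ℝ} (hb : Summable fun n => |b n|)
    (hα : ∀ x, HasSum (fun n : ℕ => b n * Real.sin (n * x)) (coupling x * eigenfunction 1 x))
    (φ : TestFunction) :
    HasSum (fun n : ℕ => ∫ t in Ioo 0 τ, b n * Real.exp (-t) * φ.sinCoeff n t)
      (∫ q in Ioo 0 π ×ˢ Ioo 0 τ,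
        coupling q.1 * (Real.exp (-q.2) * eigenfunction 1 q.1) * φ.toFun q.1 q.2) := by
  set G : ℝ × ℝ → ℝ := fun q => Real.exp (-q.2) * φ.toFun q.1 q.2
  have hG : Continuous G := by have := φ.continuous_toFun; fun_prop
  have hGi : Integrable G (volume.restrict (Ioo 0 π ×ˢ Ioo 0 τ)) := by
    have := integrable_mul_of_memLp (memLp_prod_of_continuous (T := τ) hG)
      (memLp_prod_of_continuous (T := τ) (f := fun _ => 1) continuous_const)
    simpa using this
  have hterm : ∀ n : ℕ, ∫ t in Ioo 0 τ, b n * Real.exp (-t) * φ.sinCoeff n t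
      = ∫ q in Ioo 0 π ×ˢ Ioo 0 τ, b n * Real.sin (n * q.1) * G q := fun n => by
    have h := setIntegral_prod_sin_mul hτ n (r := fun t => b n * Real.exp (-t)) (by fun_prop)
      φ.continuous_toFun
    rw [setIntegral_Ioo_eq hτ]
    refine Eq.trans h.symm ?_
    congr 1; funext q; simp only [G]; ring
  simp only [hterm]
  have e : ∀ q : ℝ × ℝ, coupling q.1 * (Real.exp (-q.2) * eigenfunction 1 q.1) * φ.toFun q.1 q.2
      = coupling q.1 * eigenfunction 1 q.1 * G q := fun q => by simp only [G]; ring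
  simp only [e]
  refine hasSum_integral_of_dominated_convergence (fun n q => |b n| * ‖G q‖)
    (fun n => Continuous.aestronglyMeasurable (by fun_prop)) (fun n => ae_of_all _ fun q => ?_)
    (ae_of_all _ fun q => hb.mul_right _) ?_ (ae_of_all _ fun q => (hα q.1).mul_right _)
  · rw [norm_mul, norm_mul]
    refine mul_le_mul_of_nonneg_right ?_ (norm_nonneg _)
    exact mul_le_of_le_one_right (abs_nonneg _) (Real.abs_sin_le_one _)
  · simp only [tsum_mul_right]
    exact hGi.norm.const_mul _

/-- The existence of a solution with initial datum `(0, w₁)` for every boundary control. -/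
theorem exists_isTranspositionSolution {T : ℝ} (hT : 0 < T) {v : ℝ → ℝ}
    (hv : MemLp v 2 (volume.restrict (Ioo 0 T))) :
    ∃ (y z : ℝ × ℝ → ℝ) (Y Z : ℝ → Hneg1),
      IsTranspositionSolution T coupling 0 (w 1) v y z Y Z := by
  obtain ⟨b, hb0, hbs, hα⟩ := exists_sinCoeff_coupling_mul
  set B := ∑' n, |b n|
  have hbB : ∀ n, |b n| ≤ B := fun n => hbs.le_tsum n fun _ _ => abs_nonneg _
  have hvi : Integrable v (volume.restrict (Ioo 0 T)) := hv.integrable one_le_two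
  -- Mode `n` must solve `yₙ' = -n² yₙ + (2/π) n v + bₙ e^{-t}` from zero data; the factor `n` is
  -- taken out of the forcing.
  set h₀ : ℕ → ℝ → ℝ := fun n s => 2 / π * v s + b n / n * Real.exp (-s)
  set h : ℕ → ℝ → ℝ := fun n => (Ioo 0 T).indicator (h₀ n)
  have hh₀ : ∀ n, MemLp (h₀ n) 2 (volume.restrict (Ioo 0 T)) := fun n =>
    (hv.const_mul _).add (memLp_Ioo_of_continuousOn (by fun_prop))
  have hhm : ∀ n, MemLp (h n) 2 (volume.restrict (Ioo 0 T)) := fun n =>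
    (hh₀ n).ae_eq (indicator_ae_eq_restrict measurableSet_Ioo).symm
  have hhi : ∀ n c d, IntervalIntegrable (h n) volume c d := fun n c d =>
    ((integrable_indicator_iff measurableSet_Ioo).2
      ((hh₀ n).integrable one_le_two)).intervalIntegrable
  -- From `(p + q)² ≤ 2 p² + 2 q²` for the two parts of the forcing.
  set K := 2 * (2 / π) ^ 2 * (∫ t in Ioo 0 T, v t ^ 2) + 2 * B ^ 2 * T with hKdef
  have hK0 : 0 ≤ K := by
    have : 0 ≤ ∫ t in Ioo 0 T, v t ^ 2 := integral_nonneg fun _ => sq_nonneg _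
    positivity
  have hhK : ∀ n, ∫ t in Ioo 0 T, h n t ^ 2 ≤ K := by
    intro n
    have e : ∫ t in Ioo 0 T, (2 * (2 / π) ^ 2 * v t ^ 2 + 2 * B ^ 2) = K := by
      rw [integral_add (hv.integrable_sq.const_mul _) (integrable_const _), integral_const_mul,
        setIntegral_const]
      simp [hKdef, hT.le]
      ring
    rw [← e]
    refine integral_mono_ae (hhm n).integrable_sq
      ((hv.integrable_sq.const_mul _).add (integrable_const _)) ?_
    filter_upwards [ae_restrict_mem measurableSet_Ioo] with t ht
    simp only [h, indicator_of_mem ht, h₀]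
    have h1 : (b n / n * Real.exp (-t)) ^ 2 ≤ B ^ 2 := by
      refine sq_le_sq' ?_ ?_ <;>
      [apply neg_le_of_abs_le; apply le_of_abs_le] <;>
      · rw [abs_mul, abs_div, Real.abs_exp, Nat.abs_cast]
        have h2 : |b n| / n ≤ B := by
          rcases Nat.eq_zero_or_pos n with rfl | hn
          · simpa using (abs_nonneg _).trans (hbB 0)
          · exact (div_le_self (abs_nonneg _) (by exact_mod_cast hn)).trans (hbB n)
        exact (mul_le_of_le_one_right (by positivity)
          (Real.exp_le_one_iff.2 (by linarith [ht.1]))).trans h2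
    nlinarith [sq_nonneg (2 / π * v t - b n / n * Real.exp (-t))]
  set y : ℕ → ℝ → ℝ := fun n t => n * expConv ((n : ℝ) ^ 2) (h n) t
  have hyc : ∀ n, Continuous (y n) := fun n =>
    continuous_const.mul (continuous_expConv _ (hhi n))
  have hysq : ∀ n, ∀ t ∈ Icc 0 T,
      y n t ^ 2 ≤ expConv ((n : ℝ) ^ 2) (fun s => h n s ^ 2) t := by
    intro n t ht
    rcases Nat.eq_zero_or_pos n with rfl | hn
    · simp only [y, Nat.cast_zero, zero_mul]
      rw [expConv_eq_integral _ _ ht.1]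
      simpa using integral_nonneg fun _ => by positivity
    have hn' : (0 : ℝ) < (n : ℝ) ^ 2 := by positivity
    have h1 := sq_expConv_le hn' ht.1
      ((hhm n).mono_measure (Measure.restrict_mono (Ioo_subset_Ioo_right ht.2) le_rfl))
    have h2 := mul_le_mul_of_nonneg_left h1 hn'.le
    rw [← mul_assoc, mul_inv_cancel₀ hn'.ne', one_mul] at h2
    simpa only [y, mul_pow] using h2
  -- `K + 1` bounds both `|yₙ|`, since `yₙ² ≤ K ≤ (K + 1)²`, and `n² ∫ yₙ²`, which is at most `K`.
  obtain ⟨f, Y, hrep, hweak, hstrong⟩ := exists_curve_of_sinCoeff (T := T) (K := K + 1) hyc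
    (fun n t ht => by
      have h1 := (hysq n t ht).trans ((expConv_le_integral (sq_nonneg _) ht
        (fun s => sq_nonneg _) (hhm n).integrable_sq).trans (hhK n))
      exact abs_le_of_sq_le_sq (by nlinarith) (by linarith))
    (fun n => by
      rcases Nat.eq_zero_or_pos n with rfl | hn
      · simp [y]
      have hn' : (0 : ℝ) < (n : ℝ) ^ 2 := by positivity
      have h1 := (mul_integral_expConv_le (a := (n : ℝ) ^ 2) hT.le (fun s => sq_nonneg _)
        (hhm n).integrable_sq).trans (hhK n)
      have h2 : ∫ t in Ioo 0 T, y n t ^ 2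
          ≤ ∫ t in Ioo 0 T, expConv ((n : ℝ) ^ 2) (fun s => h n s ^ 2) t := by
        refine setIntegral_mono_on ?_ ?_ measurableSet_Ioo fun t ht =>
          hysq n t (Ioo_subset_Icc_self ht)
        · exact ((hyc n).pow 2).integrableOn_Icc.mono_set Ioo_subset_Icc_self
        · refine (continuous_expConv _ fun c d => ?_).integrableOn_Icc.mono_set Ioo_subset_Icc_self
          have e : (fun s => h n s ^ 2) = (Ioo 0 T).indicator fun s => h₀ n s ^ 2 := by
            funext s
            by_cases hs : s ∈ Ioo 0 T <;> simp [h, hs]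
          rw [e]
          exact ((integrable_indicator_iff measurableSet_Ioo).2
            (hh₀ n).integrable_sq).intervalIntegrable
      rw [mul_one_div, le_div_iff₀ hn']
      nlinarith)
  refine ⟨f, fun q => Real.exp (-q.2) * eigenfunction 1 q.1, Y, fun t => Real.exp (-t) • w 1,
    hrep, isL2CurveRep_exp_eigenfunction T, fun τ hτ φ => ?_,
    fun τ hτ ψ => exp_eigenfunction_eq hτ.1 ψ⟩
  have hvτ : Integrable v (volume.restrict (Ioo 0 τ)) :=
    hvi.mono_measure (Measure.restrict_mono (Ioo_subset_Ioo_right hτ.2) le_rfl)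
  have hGc := φ.continuous_dt_add_dxx
  set G : ℝ × ℝ → ℝ := fun q => φ.dt q.1 q.2 + φ.dxx q.1 q.2
  have hlimA : Tendsto (fun N => ∑ n ∈ Finset.range N, y n τ * φ.sinCoeff n τ) atTop
      (𝓝 (Y τ (φ.slice τ))) := by
    have := ((ContinuousLinearMap.apply ℝ ℝ (φ.slice τ)).continuous.tendsto _).comp (hstrong τ hτ)
    refine this.congr fun N => ?_
    rw [Function.comp_apply, map_sum]
    refine Finset.sum_congr rfl fun n _ => ?_
    rw [map_smul, ContinuousLinearMap.apply_apply, toHneg1_sinL2_slice, smul_eq_mul]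
  have hlimB : Tendsto (fun N => ∑ n ∈ Finset.range N,
      ∫ t in (0 : ℝ)..τ, y n t * (deriv (φ.sinCoeff n) t - (n : ℝ) ^ 2 * φ.sinCoeff n t)) atTop
      (𝓝 (∫ q in Ioo 0 π ×ˢ Ioo 0 τ, f q * G q)) := by
    have h1 := hweak ((Ioo 0 π ×ˢ Ioo 0 τ).indicator G)
      ((memLp_prod_of_continuous hGc).indicator (measurableSet_Ioo.prod measurableSet_Ioo))
    simp only [setIntegral_mul_indicator hτ.2] at h1
    refine h1.congr fun N => ?_
    simp only [Finset.sum_mul]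
    rw [integral_finsetSum]
    · refine Finset.sum_congr rfl fun n _ => ?_
      rw [setIntegral_prod_sin_mul hτ.1 n (hyc n) hGc]
      simp only [G, φ.integral_dt_add_dxx_mul_sin]
    · intro n _
      have := hyc n
      exact MemLp.integrable_mul (memLp_prod_of_continuous (by fun_prop))
        (memLp_prod_of_continuous hGc)
  have hC := (hasSum_integral_mul_sinCoeff hvτ φ).add (hasSum_integral_sinCoeff hτ.1 hbs hα φ)
  -- The weak equation of mode `n`. At `n = 0` the division in `h₀` loses `bₙ`, which is harmless
  -- because `b 0 = 0`.
  have hid : ∀ n : ℕ, y n τ * φ.sinCoeff n τ - ∫ t in (0 : ℝ)..τ,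
      y n t * (deriv (φ.sinCoeff n) t - (n : ℝ) ^ 2 * φ.sinCoeff n t)
      = (∫ t in Ioo 0 τ, 2 / π * (v t * (n * φ.sinCoeff n t)))
        + ∫ t in Ioo 0 τ, b n * Real.exp (-t) * φ.sinCoeff n t := by
    intro n
    have hcn := φ.continuous_sinCoeff n
    have h1 := integral_expConv_mul (a := (n : ℝ) ^ 2) (hhi n 0 τ)
      (fun t => (φ.hasDerivAt_sinCoeff n t).differentiableAt.hasDerivAt)
      (φ.continuous_deriv_sinCoeff n)
    have e1 : ∫ t in (0 : ℝ)..τ, y n t * (deriv (φ.sinCoeff n) t - (n : ℝ) ^ 2 * φ.sinCoeff n t)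
        = n * ∫ t in (0 : ℝ)..τ, expConv ((n : ℝ) ^ 2) (h n) t *
          (deriv (φ.sinCoeff n) t - (n : ℝ) ^ 2 * φ.sinCoeff n t) := by
      rw [← intervalIntegral.integral_const_mul]
      simp only [y, mul_assoc]
    have e2 : (∫ t in Ioo 0 τ, 2 / π * (v t * (n * φ.sinCoeff n t)))
        + (∫ t in Ioo 0 τ, b n * Real.exp (-t) * φ.sinCoeff n t)
        = n * ∫ t in (0 : ℝ)..τ, h n t * φ.sinCoeff n t := by
      rw [← setIntegral_Ioo_eq hτ.1, ← integral_const_mul, ← integral_add]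
      · refine setIntegral_congr_fun measurableSet_Ioo fun t ht => ?_
        simp only [h, h₀, indicator_of_mem (Ioo_subset_Ioo_right hτ.2 ht)]
        rcases Nat.eq_zero_or_pos n with rfl | hn
        · simp [hb0]
        have hn' : (n : ℝ) ≠ 0 := by positivity
        field_simp
      · refine Integrable.const_mul (integrable_mul_of_memLp ?_
          (memLp_Ioo_of_continuousOn (by fun_prop))) _
        exact hv.mono_measure (Measure.restrict_mono (Ioo_subset_Ioo_right hτ.2) le_rfl)
      · exact Continuous.integrableOn_Icc (by fun_prop) |>.mono_set Ioo_subset_Icc_self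
    rw [e1, e2, h1]
    simp only [y]
    ring
  -- Partial sums of the modal identities converge on both sides; equating the limits gives the
  -- equation of `y`.
  have hfin := tendsto_nhds_unique (hlimA.sub hlimB) (hC.tendsto_sum_nat.congr fun N => by
    rw [← Finset.sum_sub_distrib]
    exact Finset.sum_congr rfl fun n _ => (hid n).symm)
  have hfτ : MemLp f 2 (volume.restrict (Ioo 0 π ×ˢ Ioo 0 τ)) :=
    hrep.memLp.mono_measure (Measure.restrict_mono
      (Set.prod_mono le_rfl (Ioo_subset_Ioo_right hτ.2)) le_rfl)
  rw [integral_add (integrable_mul_of_memLp hfτ (memLp_prod_of_continuous hGc))]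
  · rw [zero_apply, sub_zero]
    linarith
  · have h1 := continuous_coupling
    have h2 := continuous_eigenfunction 1
    exact integrable_mul_of_memLp (memLp_prod_of_continuous (by fun_prop))
      (memLp_prod_of_continuous φ.continuous_toFun)

end HeatControl

end

theorem mainTheorem5 (T : ℝ) (hT : 0 < T) :
    ∃ k₁ ∈ Set.Icc (1 : ℕ) 7, ∀ v : ℝ → ℝ, MemLp v 2 (volume.restrict (Ioo 0 T)) →
      (∃ (y z : ℝ × ℝ → ℝ) (Y Z : ℝ → HeatControl.Hneg1),
        HeatControl.IsTranspositionSolution T HeatControl.coupling 0 (HeatControl.w k₁) v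
          y z Y Z) ∧
      ∀ (y z : ℝ × ℝ → ℝ) (Y Z : ℝ → HeatControl.Hneg1),
        HeatControl.IsTranspositionSolution T HeatControl.coupling 0 (HeatControl.w k₁) v
          y z Y Z → Y T ≠ 0 :=
  ⟨1, by simp, fun _ hv => ⟨HeatControl.exists_isTranspositionSolution hT hv,
    fun _ _ _ _ h => HeatControl.apply_ne_zero_of_isTranspositionSolution hT hv h⟩⟩
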